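/- **Shadow principle.** Let $\Gamma$ be a group acting by isometries and properly discontinuously on hyperbolic space $\mathbb{H}^d$, non-elementary (its limit set has more than two points) and not convex-cocompact, and fix $x_0\in\mathbb{H}^d$. Write $\|g\|=d(x_0,gx_0)$, $B_r=\{g\in\Gamma:\|g\|<r\}$, $(x|y)_z=\frac12\big(d(x,z)+d(z,y)-d(x,y)\big)$, and for $A\subseteq\Gamma$ let $\mathcal P_A(s)=\sum_{g\in A}e^{-s\|g\|}$ and let $\delta_A$ be the abscissa of convergence of $\mathcal P_A(s)$, $s\ge 0$. *Construction of $F$.* Choose $a,b\in\Gamma$ with $\|a^n\|,\|b^n\|\to\infty$, $\sigma:=\sup_{n,m\in\mathbb Z}(a^nx_0|b^mx_0)_{x_0}<\infty$ and $\|a\|\ge 10^3\|b\|>10^6(3+\sigma)$, and put $C=10^{-3}\|a\|$. Say that $h\in\Gamma$ has property (A) if there are $n\ge1$ and points $x_0=z_0,z_1,\dots,z_n=hx_0$ such that in the sequence $(a^{-1}x_0,z_0,\dots,z_n,hax_0)$ consecutive points are at distance at least $\|a\|$ and, for any three consecutive points $p,q,r$, $(p|r)_q\le 10^{-6}\|a\|$.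 Choose a map $\Phi$ from $\Gamma$ to the set of elements with (A) such that $\Phi(g)=g$ if $g$ has (A), $\Phi(g)=bab$ if $\|g\|<\|a\|$, and $\Phi(g)\in\{g,bg,gb,bgb\}$ if $\|g\|\ge\|a\|$. For $A\subseteq\Gamma$ let $\mathcal W(A)=\{g_1ag_2a\cdots ag_n: n\ge1,\ g_i\in A\}$. Enumerate $\Gamma=\{\mathfrak g_1,\mathfrak g_2,\dots\}$. Let $0<\epsilon<1$, let $r_0>0$ be such that $\#B_r\le e^{(1+0.001\epsilon)\delta_\Gamma r}$ for all $r\ge r_0$, and let $R_0>10^7(C+r_0)(1+\delta_\Gamma)/(\delta_\Gamma\epsilon)$ be such that $\#(B_{R_0}\cap\Phi(\Gamma))\ge e^{(1-0.001\epsilon)\delta_\Gamma R_0}$. Let $K_0$ be a maximal subset of $(B_{R_0}\cap\Phi(\Gamma))\setminus B_{(1-0.003\epsilon)R_0}$ with $d(gx_0,hx_0)>0.004\,\epsilon R_0$ for distinct $g,h\in K_0$. For $k\ge1$ choose inductively $\beta_k$, $R_k$, $\phi_k$, with $\varphi_k:=\Phi(\phi_k)\,a\,\Phi(\mathfrak g_k)$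 and $F_k:=\mathcal W(K_0\cup\{\varphi_1,\dots,\varphi_{k-1}\})$, so that 1. $\delta_{F_k}<\beta_k<\delta_{F_k}+2^{-k}$, $\mathcal P_{F_k}(\beta_k)>2^k$, and $\beta_k<\beta_{k-1}$ if $k\ge2$; 2. $R_k>100R_{k-1}$; $K_0\cup\{\varphi_1,\dots,\varphi_{k-1}\}\subseteq B_{R_k-10^4C}$; and for every $1\le j\le k$, with $M=\mathcal P_{F_k}(\beta_j)$, there is $0<e<\frac12$ with $2eM<1$, $\frac{M+2e+4Me}{1-2eM}<(2-2^{j-k-1})\mathcal P_{F_j}(\beta_j)$ and $e^{-\beta_jR_k}\le e$; 3. $\|\phi_k\|\ge R_k+2500C$, and there are $x,y\in\mathbb H^d$ with $d(x,x_0)\le10C$, $d(y,\phi_kx_0)\le10C$ such that the geodesic $[x,y]$ has distance at least $10C$ from $\Gamma x_0$. Finally let $F=\bigcup_kF_k=\mathcal W(K_0\cup\{\varphi_1,\varphi_2,\dots\})$. *Statement.* For $F$ obtained from any such choices, let $\mu$ be a Patterson–Sullivan measure for $F$, that is, a weak limit on the compactification $\mathbb H^d\cup\partial\mathbb H^d$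 of the probability measures $\mathcal P_F(s_n)^{-1}\sum_{g\in F}e^{-s_n\|g\|}\mathrm{Dir}_{gx_0}$ for some sequence $s_n\to\delta_F$ with $s_n>\delta_F$. For $y\in\mathbb H^d$ and $r>0$ let $\mathcal S(y,r)=\{z\in\mathbb H^d\cup\partial\mathbb H^d:(z|x_0)_y\le r\}$, where the Gromov product is extended to $z\in\partial\mathbb H^d$ by taking lower limits (in fact limits). Then, with $K=e^{\delta_F\cdot10^7C}$, $$\frac1K\,e^{-\delta_F\|g\|}\ \le\ \mu\big(\mathcal S(gx_0,8C)\big)\ \le\ e^{-\delta_F\|g\|}\qquad\text{for every } g\in F.$$ -/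

import Mathlib

open Filter Topology MeasureTheory

noncomputable section

namespace Shadow

/-- Hyperbolic space `ℍ^d` in the Poincaré ball model: the open unit ball of `ℝ^d`. It carries the
hyperbolic distance `hdist` below (not the Euclidean distance that the subtype inherits); the
subtype topology is the topology of `hdist`. -/
abbrev Hyp (d : ℕ) : Type := Metric.ball (0 : EuclideanSpace ℝ (Fin d)) 1

/-- The compactification `ℍ^d ∪ ∂ℍ^d`: the closed unit ball, with its Euclidean topology and
Borel σ-algebra. The boundary at infinity is the unit sphere. -/
abbrev HypBar (d : ℕ) : Type := Metric.closedBall (0 : EuclideanSpace ℝ (Fin d)) 1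

/-- The inclusion of `ℍ^d` into `ℍ^d ∪ ∂ℍ^d`. -/
def toBar {d : ℕ} (x : Hyp d) : HypBar d := ⟨x.1, Metric.ball_subset_closedBall x.2⟩

/-- The hyperbolic distance (curvature `-1`) of the ball model:
`sinh² (d(x,y)/2) = |x-y|² / ((1-|x|²)(1-|y|²))`. -/
def hdist {d : ℕ} (x y : Hyp d) : ℝ :=
  2 * Real.arsinh (‖x.1 - y.1‖ / Real.sqrt ((1 - ‖x.1‖ ^ 2) * (1 - ‖y.1‖ ^ 2)))

/-- The geodesic segment `[x, y]`. -/
def geod {d : ℕ} (x y : Hyp d) : Set (Hyp d) := {p | hdist x p + hdist p y = hdist x y}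

/-- The Gromov product `(x | y)_z`. -/
def gromov {d : ℕ} (x y z : Hyp d) : ℝ := (hdist x z + hdist z y - hdist x y) / 2

/-- The Gromov product `(ζ | y)_z` for `ζ ∈ ℍ^d ∪ ∂ℍ^d`: the lower limit of `(w | y)_z` as
`w ∈ ℍ^d` tends to `ζ`. For `ζ ∈ ℍ^d` this is `(ζ | y)_z`, by continuity. -/
def gromovBar {d : ℕ} (ζ : HypBar d) (y z : Hyp d) : ℝ :=
  liminf (fun w : Hyp d => gromov w y z) (comap toBar (𝓝 ζ))

/-- The shadow `S(y, r) = {ζ ∈ ℍ^d ∪ ∂ℍ^d : (ζ | x₀)_y ≤ r}`. -/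
def shadow {d : ℕ} (x₀ y : Hyp d) (r : ℝ) : Set (HypBar d) := {ζ | gromovBar ζ x₀ y ≤ r}

/-- `(z 0, …, z n)` is a `(c, D)`-chain: inner Gromov products are at most `c`, and consecutive
distances are at least `D`. -/
def IsCDChain {d : ℕ} (c D : ℝ) (n : ℕ) (z : ℕ → Hyp d) : Prop :=
  (∀ i, 0 < i → i < n → gromov (z (i - 1)) (z (i + 1)) (z i) ≤ c) ∧
    ∀ i, i < n → D ≤ hdist (z i) (z (i + 1))

section Group

variable {d : ℕ} {Γ : Type*} [Group Γ] [MulAction Γ (Hyp d)]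

/-- `‖g‖ = d(x₀, g x₀)`. -/
def len (x₀ : Hyp d) (g : Γ) : ℝ := hdist x₀ (g • x₀)

/-- `B_r = {g : ‖g‖ < r}`. -/
def ballOf (Γ : Type*) [Group Γ] [MulAction Γ (Hyp d)] (x₀ : Hyp d) (r : ℝ) : Set Γ :=
  {g | len x₀ g < r}

/-- The Poincaré series `P_A(s) = ∑_{g ∈ A} e^{-s‖g‖}`, with values in `[0, ∞]`. -/
def poincare (x₀ : Hyp d) (A : Set Γ) (s : ℝ) : ENNReal :=
  ∑' g : A, ENNReal.ofReal (Real.exp (-s * len x₀ (g : Γ)))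

/-- The critical exponent `δ_A`: the abscissa of convergence of `P_A(s)`, `0 ≤ s < ∞`. -/
def critExp (x₀ : Hyp d) (A : Set Γ) : ℝ := sInf {s : ℝ | 0 ≤ s ∧ poincare x₀ A s < ⊤}

/-- The limit set: points of `∂ℍ^d` in the closure of the orbit `Γ x₀`. -/
def limitSet (Γ : Type*) [Group Γ] [MulAction Γ (Hyp d)] (x₀ : Hyp d) : Set (HypBar d) :=
  {ξ | ‖ξ.1‖ = 1 ∧ ξ ∈ closure (Set.range fun g : Γ => toBar (g • x₀))}

/-- `Γ` is non-elementary: its limit set has more than two points. -/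
def IsNonElementary (Γ : Type*) [Group Γ] [MulAction Γ (Hyp d)] (x₀ : Hyp d) : Prop :=
  2 < (limitSet Γ x₀).encard

/-- `Γ` is convex-cocompact: all geodesics between orbit points stay in a bounded neighborhood of
the orbit. -/
def IsConvexCocompact (Γ : Type*) [Group Γ] [MulAction Γ (Hyp d)] (x₀ : Hyp d) : Prop :=
  ∃ M : ℝ, 0 < M ∧ ∀ g h : Γ, ∀ p ∈ geod (g • x₀) (h • x₀), ∃ γ : Γ, hdist p (γ • x₀) < M

/-- The set `O_{M₁, M₂}` of those `g` for which some `x, y` with `d(x, x₀), d(y, g x₀) ≤ M₁`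
satisfy `d([x, y], Γ x₀) ≥ M₂`. -/
def excursions (Γ : Type*) [Group Γ] [MulAction Γ (Hyp d)] (x₀ : Hyp d) (M₁ M₂ : ℝ) : Set Γ :=
  {g | ∃ x y : Hyp d, hdist x x₀ ≤ M₁ ∧ hdist y (g • x₀) ≤ M₁ ∧
    ∀ p ∈ geod x y, ∀ γ : Γ, M₂ ≤ hdist p (γ • x₀)}

/-- There are `n ≥ 1` and points `x₀ = z₀, z₁, …, zₙ = h x₀` such that
`(a⁻¹ x₀, z₀, …, zₙ, h a x₀)` has Gromov products `≤ 10⁻⁶ ‖a‖` and consecutive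
distances `≥ ‖a‖`. Here `w (i + 1) = zᵢ`. -/
def PropertyA (x₀ : Hyp d) (a h : Γ) : Prop :=
  ∃ (n : ℕ) (w : ℕ → Hyp d), 1 ≤ n ∧ w 0 = a⁻¹ • x₀ ∧ w 1 = x₀ ∧ w (n + 1) = h • x₀ ∧
    w (n + 2) = (h * a) • x₀ ∧ IsCDChain (len x₀ a / 10 ^ 6) (len x₀ a) (n + 2) w

/-- `A` is `r`-separated: `d(g x₀, h x₀) > r` for distinct `g, h ∈ A`. -/
def IsSep (x₀ : Hyp d) (r : ℝ) (A : Set Γ) : Prop :=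
  ∀ g ∈ A, ∀ h ∈ A, g ≠ h → r < hdist (g • x₀) (h • x₀)

/-- The measure `μ^s = P_A(s)⁻¹ ∑_{g ∈ A} e^{-s‖g‖} Dir_{g x₀}` on `ℍ^d ∪ ∂ℍ^d`. -/
def orbitMeasure (x₀ : Hyp d) (A : Set Γ) (s : ℝ) : Measure (HypBar d) :=
  (poincare x₀ A s)⁻¹ • Measure.sum fun g : A =>
    ENNReal.ofReal (Real.exp (-s * len x₀ (g : Γ))) • Measure.dirac (toBar ((g : Γ) • x₀))

/-- `μ` is a Patterson–Sullivan measure for `A`: the weak limit of the probability measures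
`μ^{s_n}` for some sequence `s_n > δ_A` tending to `δ_A`. -/
def IsPattersonSullivan (x₀ : Hyp d) (A : Set Γ) (μ : ProbabilityMeasure (HypBar d)) : Prop :=
  ∃ (s : ℕ → ℝ) (ν : ℕ → ProbabilityMeasure (HypBar d)),
    (∀ n, critExp x₀ A < s n) ∧ Tendsto s atTop (𝓝 (critExp x₀ A)) ∧
    (∀ n, (ν n : Measure (HypBar d)) = orbitMeasure x₀ A (s n)) ∧ Tendsto ν atTop (𝓝 μ)

end Group

/-- `(g₁, …, gₙ) ↦ g₁ a g₂ a ⋯ a gₙ`. -/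
def wordMap {Γ : Type*} [Group Γ] (a : Γ) : List Γ → Γ
  | [] => 1
  | [g] => g
  | g :: h :: l => g * a * wordMap a (h :: l)

/-- All `g₁ a g₂ a ⋯ a gₙ` with `n ≥ 1` and `gᵢ ∈ A`. -/
def wordSet {Γ : Type*} [Group Γ] (a : Γ) (A : Set Γ) : Set Γ :=
  {u | ∃ l : List Γ, l ≠ [] ∧ (∀ g ∈ l, g ∈ A) ∧ wordMap a l = u}

/-- The objects chosen in the construction of the set `F`. Sequences are indexed by `k ≥ 1`, except
that `R` starts with `R 0`; the other values at `0` play no role. No condition is imposed here;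
see `Choices.IsAdmissible`. -/
structure Choices (Γ : Type*) where
  /-- the elements `a`, `b` -/
  a : Γ
  b : Γ
  /-- the map `Φ` -/
  Φ : Γ → Γ
  /-- the enumeration `𝔤₁, 𝔤₂, …` of `Γ` -/
  enum : ℕ → Γ
  ε : ℝ
  /-- the finite set `K` -/
  K : Set Γ
  /-- the radii `R₀, R₁, …` -/
  R : ℕ → ℝ
  /-- the excursions `ϕ₁, ϕ₂, …` -/
  exc : ℕ → Γ
  /-- the exponents `β₁, β₂, …` -/
  β : ℕ → ℝ

namespace Choices

variable {d : ℕ} {Γ : Type*} [Group Γ] [MulAction Γ (Hyp d)]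

/-- `C = ‖a‖ / 1000`. -/
def C (D : Choices Γ) (x₀ : Hyp d) : ℝ := len x₀ D.a / 1000

/-- `φ_k = Φ(ϕ_k) · a · Φ(𝔤_k)`. -/
def letter {Γ : Type*} [Group Γ] (D : Choices Γ) (k : ℕ) : Γ :=
  D.Φ (D.exc k) * D.a * D.Φ (D.enum k)

/-- `K ∪ {φ₁, …, φ_{i-1}}`. -/
def alphabet {Γ : Type*} [Group Γ] (D : Choices Γ) (i : ℕ) : Set Γ :=
  D.K ∪ {g | ∃ k, 1 ≤ k ∧ k < i ∧ g = D.letter k}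

/-- `F_i`, the words in `K ∪ {φ₁, …, φ_{i-1}}`. -/
def stage {Γ : Type*} [Group Γ] (D : Choices Γ) (i : ℕ) : Set Γ := wordSet D.a (D.alphabet i)

/-- `F`, the words in `K ∪ {φ₁, φ₂, …}`. -/
def F {Γ : Type*} [Group Γ] (D : Choices Γ) : Set Γ :=
  wordSet D.a (D.K ∪ {g | ∃ k, 1 ≤ k ∧ g = D.letter k})

/-- The requirements under which the choices are made, in the order of the construction. -/
structure IsAdmissible (D : Choices Γ) (x₀ : Hyp d) : Prop where
  tendsto_a : Tendsto (fun n : ℕ => len x₀ (D.a ^ n)) atTop atTop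
  tendsto_b : Tendsto (fun n : ℕ => len x₀ (D.b ^ n)) atTop atTop
  bddAbove : BddAbove (Set.range fun p : ℤ × ℤ =>
    gromov ((D.a ^ p.1) • x₀) ((D.b ^ p.2) • x₀) x₀)
  le_a : 10 ^ 3 * len x₀ D.b ≤ len x₀ D.a
  lt_b : 10 ^ 6 * (3 + ⨆ p : ℤ × ℤ, gromov ((D.a ^ p.1) • x₀) ((D.b ^ p.2) • x₀) x₀)
    < 10 ^ 3 * len x₀ D.b
  Φ_prop : ∀ g, PropertyA x₀ D.a (D.Φ g)
  Φ_fix : ∀ g, PropertyA x₀ D.a g → D.Φ g = g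
  Φ_small : ∀ g, len x₀ g < len x₀ D.a → D.Φ g = D.b * D.a * D.b
  Φ_mem : ∀ g, len x₀ D.a ≤ len x₀ g →
    D.Φ g = g ∨ D.Φ g = D.b * g ∨ D.Φ g = g * D.b ∨ D.Φ g = D.b * g * D.b
  enum_surj : ∀ g, ∃ k, 1 ≤ k ∧ D.enum k = g
  ε_pos : 0 < D.ε
  ε_lt : D.ε < 1
  /-- the choice of `r₀`, and `R₀ > 10⁷ (C + r₀)(1 + δ_Γ) / (δ_Γ ε)` -/
  R_zero : ∃ r₀ : ℝ, 0 < r₀ ∧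
    (∀ r, r₀ ≤ r → ((ballOf Γ x₀ r).ncard : ℝ) ≤
      Real.exp ((1 + 0.001 * D.ε) * critExp x₀ (Set.univ : Set Γ) * r)) ∧
    10 ^ 7 * (D.C x₀ + r₀) * (1 + critExp x₀ (Set.univ : Set Γ))
      < D.R 0 * (critExp x₀ (Set.univ : Set Γ) * D.ε)
  R_zero_card : Real.exp ((1 - 0.001 * D.ε) * critExp x₀ (Set.univ : Set Γ) * D.R 0)
    ≤ ((ballOf Γ x₀ (D.R 0) ∩ Set.range D.Φ).ncard : ℝ)
  /-- `K` is a maximal `0.004εR₀`-separated subset of the annulus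
  `B_{R₀} ∩ Φ(Γ) ∖ B_{(1-0.003ε)R₀}` -/
  K_max : Maximal (fun A : Set Γ =>
    A ⊆ (ballOf Γ x₀ (D.R 0) ∩ Set.range D.Φ) \ ballOf Γ x₀ ((1 - 0.003 * D.ε) * D.R 0) ∧
      IsSep x₀ (0.004 * D.ε * D.R 0) A) D.K
  /-- `β_k ∈ (α_k, α_k + 2^{-k})`, where `α_k` is the critical exponent of `F_k` -/
  β_gt : ∀ k, 1 ≤ k → critExp x₀ (D.stage k) < D.β k
  β_lt : ∀ k, 1 ≤ k → D.β k < critExp x₀ (D.stage k) + (1 / 2) ^ k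
  β_anti : ∀ k, 1 ≤ k → D.β (k + 1) < D.β k
  β_large : ∀ k, 1 ≤ k → 2 ^ k < poincare x₀ (D.stage k) (D.β k)
  R_succ : ∀ k, 1 ≤ k → 100 * D.R (k - 1) < D.R k
  R_ball : ∀ k, 1 ≤ k → D.alphabet k ⊆ ballOf Γ x₀ (D.R k - 10 ^ 4 * D.C x₀)
  /-- with `M_j = P_{F_k}(β_j)`: there is a small `e = ε_j` with
  `(M_j + 2e + 4 M_j e) / (1 - 2 e M_j) < (2 - 2^{j-k-1}) P_{F_j}(β_j)` and `e^{-β_j R_k} ≤ e` -/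
  R_exp : ∀ k j, 1 ≤ j → j ≤ k → ∃ e : ℝ, 0 < e ∧ e < 1 / 2 ∧
    2 * e * (poincare x₀ (D.stage k) (D.β j)).toReal < 1 ∧
    ((poincare x₀ (D.stage k) (D.β j)).toReal + 2 * e
        + 4 * (poincare x₀ (D.stage k) (D.β j)).toReal * e)
      / (1 - 2 * e * (poincare x₀ (D.stage k) (D.β j)).toReal)
      < (2 - (1 / 2) ^ (k + 1 - j)) * (poincare x₀ (D.stage j) (D.β j)).toReal ∧
    Real.exp (-D.β j * D.R k) ≤ e
  exc_mem : ∀ k, 1 ≤ k → D.exc k ∈ excursions Γ x₀ (10 * D.C x₀) (10 * D.C x₀)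
  exc_far : ∀ k, 1 ≤ k → D.exc k ∉ ballOf Γ x₀ (D.R k + 2500 * D.C x₀)

end Choices

end Shadow

end

namespace Shadow

/-! ### The hyperbolic distance of the ball model -/

section Metric

variable {d : ℕ}

/-! The estimate is read off the finite measures `orbitMeasure x₀ D.F s` and passed to the limit `s
→ δ_F`. Elements with property (A) are ends of quasi-geodesic chains, so `‖u a v‖` equals `‖u‖ +
‖v‖` up to a bounded error, and `u x₀` lies close to `[x₀, u a v x₀]`. Hence every `g a h` with `h ∈
F` lies in the shadow of `g`. Left translation is injective, so the measure of the shadow is at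
least `e^{-s(‖g‖ + ‖a‖)}`.

The upper bound needs the converse (`prefix_of_gromov_le`): an `h ∈ F` in a slightly larger shadow
of `g` is `g` itself or `g a v` with `v ∈ F`. This follows letter by letter from `head_eq`. Two
different letters of `K` are too far apart to lie along one geodesic. A letter `φ_k` begins with an
excursion that avoids the orbit, so no shorter letter can lie along a geodesic starting with `φ_k`.
The mass of the shadow is therefore at most `e^{-s‖g‖} (P_F(s)⁻¹ + e^{-s})`.

Finally `P_F(s) → ∞` as `s → δ_F`: `P_F ≥ P_{F_k} > 2^k` at `β_k`, and `δ_F < β_k` because each new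
letter is so long that it hardly changes the earlier series (`poincare_wordSet_union_le`). So the
bracket is eventually at most `1` when `δ_F > 0`; when `δ_F = 0` the upper bound is trivial. The
weak limit is handled by the portmanteau theorem, with a closed shadow from below and an open
neighbourhood of it from above. -/

theorem one_sub_sq_pos (x : Hyp d) : 0 < 1 - ‖x.1‖ ^ 2 := by
  have h : ‖x.1‖ < 1 := mem_ball_zero_iff.1 x.2
  nlinarith [norm_nonneg x.1]

theorem sinh_half_hdist (x y : Hyp d) : Real.sinh (hdist x y / 2) =
    ‖x.1 - y.1‖ / (Real.sqrt (1 - ‖x.1‖ ^ 2) * Real.sqrt (1 - ‖y.1‖ ^ 2)) := by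
  rw [hdist, mul_div_cancel_left₀ _ two_ne_zero, Real.sinh_arsinh,
    Real.sqrt_mul (one_sub_sq_pos x).le]

theorem hdist_nonneg (x y : Hyp d) : 0 ≤ hdist x y := by
  have : 0 ≤ Real.arsinh (‖x.1 - y.1‖ / Real.sqrt ((1 - ‖x.1‖ ^ 2) * (1 - ‖y.1‖ ^ 2))) :=
    Real.arsinh_nonneg_iff.2 (by positivity)
  unfold hdist
  linarith

theorem hdist_comm (x y : Hyp d) : hdist x y = hdist y x := by
  unfold hdist
  rw [norm_sub_rev, mul_comm (1 - ‖x.1‖ ^ 2)]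

theorem hdist_self (x : Hyp d) : hdist x x = 0 := by
  simp [hdist]

theorem cosh_half_hdist (x y : Hyp d) : Real.cosh (hdist x y / 2) =
    Real.sqrt (‖x.1 - y.1‖ ^ 2 + (1 - ‖x.1‖ ^ 2) * (1 - ‖y.1‖ ^ 2)) /
      (Real.sqrt (1 - ‖x.1‖ ^ 2) * Real.sqrt (1 - ‖y.1‖ ^ 2)) := by
  have hx := one_sub_sq_pos x
  have hy := one_sub_sq_pos y
  have hxy := mul_pos hx hy
  rw [hdist, mul_div_cancel_left₀ _ two_ne_zero, Real.cosh_arsinh, ← Real.sqrt_mul hx.le,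
    div_pow, Real.sq_sqrt hxy.le, ← Real.sqrt_div' _ hxy.le]
  congr 1
  rw [add_div, div_self hxy.ne', add_comm]

/-- Hyperbolic cosine of half the distance, through the inversion of `y` in the unit sphere. -/
theorem norm_mul_dist_inversion {E : Type*} [NormedAddCommGroup E] [InnerProductSpace ℝ E]
    (x y : E) (hy : y ≠ 0) :
    ‖y‖ * ‖x - (‖y‖ ^ 2)⁻¹ • y‖ =
      Real.sqrt (‖x - y‖ ^ 2 + (1 - ‖x‖ ^ 2) * (1 - ‖y‖ ^ 2)) := by
  have hy' : ‖y‖ ≠ 0 := norm_ne_zero_iff.2 hy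
  have h : (‖y‖ * ‖x - (‖y‖ ^ 2)⁻¹ • y‖) ^ 2 =
      ‖x - y‖ ^ 2 + (1 - ‖x‖ ^ 2) * (1 - ‖y‖ ^ 2) := by
    rw [mul_pow, @norm_sub_sq_real, @norm_sub_sq_real, inner_smul_right, norm_smul, norm_inv,
      norm_pow, norm_norm]
    field_simp
    ring
  rw [← h, Real.sqrt_sq (by positivity)]

/-- Euclidean Ptolemy for `x, y, z` and the inverse of `y` in the unit sphere; multiplication by
`‖y‖` turns distances to the inverse into numerators of `cosh (hdist / 2)`. For `y = 0`, where there
is no inverse, it is the triangle inequality. -/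
theorem ptolemy_inversion {E : Type*} [NormedAddCommGroup E] [InnerProductSpace ℝ E]
    (x y z : E) (hy1 : ‖y‖ < 1) :
    ‖x - z‖ * (1 - ‖y‖ ^ 2) ≤
      ‖x - y‖ * Real.sqrt (‖y - z‖ ^ 2 + (1 - ‖y‖ ^ 2) * (1 - ‖z‖ ^ 2)) +
        Real.sqrt (‖x - y‖ ^ 2 + (1 - ‖x‖ ^ 2) * (1 - ‖y‖ ^ 2)) * ‖y - z‖ := by
  rcases eq_or_ne y 0 with rfl | hy
  · simpa using norm_sub_le x z
  have hy' : 0 < ‖y‖ := norm_pos_iff.2 hy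
  have h := EuclideanGeometry.mul_dist_le_mul_dist_add_mul_dist x y z ((‖y‖ ^ 2)⁻¹ • y)
  simp only [dist_eq_norm] at h
  have h1 := norm_mul_dist_inversion x y hy
  have h2 := norm_mul_dist_inversion z y hy
  have h3 : ‖y‖ * ‖y - (‖y‖ ^ 2)⁻¹ • y‖ = 1 - ‖y‖ ^ 2 := by
    rw [norm_mul_dist_inversion y y hy, sub_self, norm_zero, zero_pow two_ne_zero, zero_add,
      Real.sqrt_mul_self]
    nlinarith
  rw [norm_sub_rev z y, mul_comm (1 - ‖z‖ ^ 2)] at h2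
  rw [← h1, ← h2, ← h3]
  have := mul_le_mul_of_nonneg_left h hy'.le
  linarith

/-- With the addition formula for `sinh` and denominators cleared, this is `ptolemy_inversion`. -/
theorem hdist_triangle (x y z : Hyp d) : hdist x z ≤ hdist x y + hdist y z := by
  suffices h : Real.sinh (hdist x z / 2) ≤ Real.sinh (hdist x y / 2 + hdist y z / 2) by
    have := Real.sinh_le_sinh.1 h
    linarith
  have hx := Real.sqrt_pos.2 (one_sub_sq_pos x)
  have hy := Real.sqrt_pos.2 (one_sub_sq_pos y)
  have hz := Real.sqrt_pos.2 (one_sub_sq_pos z)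
  have hy2 := Real.sq_sqrt (one_sub_sq_pos y).le
  have key := ptolemy_inversion x.1 y.1 z.1 (mem_ball_zero_iff.1 y.2)
  rw [Real.sinh_add, sinh_half_hdist, sinh_half_hdist, sinh_half_hdist, cosh_half_hdist,
    cosh_half_hdist, div_mul_div_comm, div_mul_div_comm, ← add_div,
    div_le_div_iff₀ (by positivity) (by positivity)]
  refine le_of_eq_of_le ?_ (mul_le_mul_of_nonneg_right key (mul_pos hx hz).le)
  linear_combination (‖x.1 - z.1‖ * Real.sqrt (1 - ‖x.1‖ ^ 2) * Real.sqrt (1 - ‖z.1‖ ^ 2)) * hy2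

/-- Ptolemy's inequality for `sinh (hdist / 2)`. -/
theorem sinh_ptolemy (x y z w : Hyp d) :
    Real.sinh (hdist x z / 2) * Real.sinh (hdist y w / 2) ≤
      Real.sinh (hdist x y / 2) * Real.sinh (hdist z w / 2) +
        Real.sinh (hdist y z / 2) * Real.sinh (hdist x w / 2) := by
  have hx := Real.sqrt_pos.2 (one_sub_sq_pos x)
  have hy := Real.sqrt_pos.2 (one_sub_sq_pos y)
  have hz := Real.sqrt_pos.2 (one_sub_sq_pos z)
  have hw := Real.sqrt_pos.2 (one_sub_sq_pos w)
  have h := EuclideanGeometry.mul_dist_le_mul_dist_add_mul_dist x.1 y.1 z.1 w.1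
  simp only [dist_eq_norm] at h
  simp only [sinh_half_hdist]
  set X := Real.sqrt (1 - ‖x.1‖ ^ 2)
  set Y := Real.sqrt (1 - ‖y.1‖ ^ 2)
  set Z := Real.sqrt (1 - ‖z.1‖ ^ 2)
  set W := Real.sqrt (1 - ‖w.1‖ ^ 2)
  have := div_le_div_of_nonneg_right h (by positivity : 0 ≤ X * Y * Z * W)
  calc _ = ‖x.1 - z.1‖ * ‖y.1 - w.1‖ / (X * Y * Z * W) := by field_simp
    _ ≤ _ := this
    _ = _ := by field_simp

theorem exp_le_sinh {u : ℝ} (hu : 1 ≤ u) : Real.exp u * (3 / 4) ≤ 2 * Real.sinh u := by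
  have h2 : Real.exp (-u) ≤ Real.exp u * (1 / 4) := by
    have h4 : (4 : ℝ) ≤ Real.exp (2 * u) := by
      have := Real.add_one_le_exp (1 : ℝ)
      have h1 := Real.exp_le_exp.2 hu
      rw [two_mul, Real.exp_add]
      nlinarith
    have : Real.exp u = Real.exp (2 * u) * Real.exp (-u) := by rw [← Real.exp_add]; ring_nf
    nlinarith [Real.exp_pos (-u)]
  rw [Real.sinh_eq]
  linarith

theorem two_sinh_le_exp (u : ℝ) : 2 * Real.sinh u ≤ Real.exp u := by
  rw [Real.sinh_eq]
  linarith [Real.exp_pos (-u)]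

/-- The four-point inequality: `ℍ^d` is `2`-hyperbolic. -/
theorem four_point (x y z w : Hyp d) : hdist x y + hdist z w ≤
    max (hdist x z + hdist y w) (hdist x w + hdist y z) + 4 := by
  -- If a distance on the left is at most `2`, triangle inequalities suffice. Otherwise `2 sinh` is
  -- comparable to `exp`, and Ptolemy's inequality becomes the claim after taking logarithms.
  by_cases h1 : hdist x y ≤ 2
  · have := hdist_triangle z x w
    have := hdist_triangle x y w
    have := hdist_comm x z
    have := le_max_left (hdist x z + hdist y w) (hdist x w + hdist y z)
    linarith
  by_cases h2 : hdist z w ≤ 2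
  · have := hdist_triangle x z y
    have := hdist_triangle z w y
    have := hdist_comm w y
    have := le_max_left (hdist x z + hdist y w) (hdist x w + hdist y z)
    linarith
  push Not at h1 h2
  have key := sinh_ptolemy x z y w
  rw [hdist_comm z y] at key
  have e1 := exp_le_sinh (u := hdist x y / 2) (by linarith)
  have e2 := exp_le_sinh (u := hdist z w / 2) (by linarith)
  have hs : ∀ p q : Hyp d, 0 ≤ 2 * Real.sinh (hdist p q / 2) := fun p q => by
    have := Real.sinh_nonneg_iff.2 (by linarith [hdist_nonneg p q] : 0 ≤ hdist p q / 2)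
    linarith
  have e3 := mul_le_mul e1 e2 (by positivity) (hs x y)
  have e4 := mul_le_mul (two_sinh_le_exp (hdist x z / 2)) (two_sinh_le_exp (hdist y w / 2))
    (hs y w) (Real.exp_pos _).le
  have e5 := mul_le_mul (two_sinh_le_exp (hdist y z / 2)) (two_sinh_le_exp (hdist x w / 2))
    (hs x w) (Real.exp_pos _).le
  set m := max (hdist x z + hdist y w) (hdist x w + hdist y z) with hm
  have e6 : Real.exp (hdist x z / 2) * Real.exp (hdist y w / 2) ≤ Real.exp (m / 2) := by
    rw [← Real.exp_add, Real.exp_le_exp]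
    linarith [le_max_left (hdist x z + hdist y w) (hdist x w + hdist y z)]
  have e7 : Real.exp (hdist y z / 2) * Real.exp (hdist x w / 2) ≤ Real.exp (m / 2) := by
    rw [← Real.exp_add, Real.exp_le_exp]
    linarith [le_max_right (hdist x z + hdist y w) (hdist x w + hdist y z)]
  have e8 : Real.exp ((hdist x y + hdist z w) / 2) =
      Real.exp (hdist x y / 2) * Real.exp (hdist z w / 2) := by
    rw [← Real.exp_add]; ring_nf
  -- Ptolemy gives `(3/4)² e^{(d(x,y) + d(z,w))/2} ≤ 2 e^{m/2}`, and `32/9 ≤ 4 ≤ e²`.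
  have h4 : (4 : ℝ) ≤ Real.exp 2 := by
    have := Real.add_one_le_exp (1 : ℝ)
    rw [show (2 : ℝ) = 1 + 1 by norm_num, Real.exp_add]
    nlinarith
  have : Real.exp ((hdist x y + hdist z w) / 2) ≤ Real.exp (m / 2 + 2) := by
    rw [Real.exp_add, e8]
    nlinarith [Real.exp_pos (m / 2)]
  have := Real.exp_le_exp.1 this
  linarith

theorem cosh_hdist (x y : Hyp d) : Real.cosh (hdist x y) =
    1 + 2 * (‖x.1 - y.1‖ ^ 2 / ((1 - ‖x.1‖ ^ 2) * (1 - ‖y.1‖ ^ 2))) := by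
  have h : Real.cosh (hdist x y) = 1 + 2 * Real.sinh (hdist x y / 2) ^ 2 := by
    have := Real.cosh_two_mul (hdist x y / 2)
    have h2 := Real.cosh_sq (hdist x y / 2)
    rw [mul_div_cancel₀ _ two_ne_zero] at this
    linarith
  rw [h, sinh_half_hdist, div_pow, mul_pow, Real.sq_sqrt (one_sub_sq_pos x).le,
    Real.sq_sqrt (one_sub_sq_pos y).le]

end Metric

/-! ### Geodesic segments through the hyperboloid model -/

section Geodesics

variable {d : ℕ}

/-- Every point of the hyperboloid `P₀² - |P|² = 1` comes from a point of the ball model. -/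
theorem exists_of_hyperboloid (P₀ : ℝ) (P : EuclideanSpace ℝ (Fin d)) (h0 : 0 < P₀)
    (h : P₀ ^ 2 - ‖P‖ ^ 2 = 1) :
    ∃ p : Hyp d, 1 - ‖p.1‖ ^ 2 = 2 / (1 + P₀) ∧ p.1 = (1 / (1 + P₀)) • P := by
  have h1 : 0 < 1 + P₀ := by linarith
  have hsq : 1 - ‖(1 / (1 + P₀)) • P‖ ^ 2 = 2 / (1 + P₀) := by
    rw [norm_smul, mul_pow, Real.norm_of_nonneg (by positivity)]
    have : ‖P‖ ^ 2 = P₀ ^ 2 - 1 := by linarith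
    rw [this]
    field_simp
    ring
  have hlt : ‖(1 / (1 + P₀)) • P‖ < 1 := by
    have : 0 < 2 / (1 + P₀) := by positivity
    rw [← hsq] at this
    nlinarith [norm_nonneg ((1 / (1 + P₀)) • P)]
  exact ⟨⟨_, mem_ball_zero_iff.2 hlt⟩, hsq, rfl⟩

/-- The Lorentz form `X₀ Y₀ - ⟨X, Y⟩` of the hyperboloid model computes `cosh ∘ hdist`. -/
theorem cosh_hdist_eq_lorentz (x y : Hyp d) : Real.cosh (hdist x y) =
    (1 + ‖x.1‖ ^ 2) / (1 - ‖x.1‖ ^ 2) * ((1 + ‖y.1‖ ^ 2) / (1 - ‖y.1‖ ^ 2)) -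
      inner ℝ ((2 / (1 - ‖x.1‖ ^ 2)) • x.1) ((2 / (1 - ‖y.1‖ ^ 2)) • y.1) := by
  have hx := one_sub_sq_pos x
  have hy := one_sub_sq_pos y
  rw [cosh_hdist, @norm_sub_sq_real, inner_smul_left, inner_smul_right]
  simp only [conj_trivial]
  field_simp
  ring

/-- Geodesic segments in `ℍ^d` exist. -/
theorem exists_mem_geod (x y : Hyp d) {t : ℝ} (ht : 0 ≤ t) (ht' : t ≤ hdist x y) :
    ∃ p ∈ geod x y, hdist x p = t := by
  set L := hdist x y with hL
  rcases (hdist_nonneg x y).eq_or_lt with h0 | hpos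
  · refine ⟨x, ?_, ?_⟩
    · simp [geod, hdist_self]
    · rw [hdist_self]; linarith
  have hS : 0 < Real.sinh L := Real.sinh_pos_iff.2 hpos
  -- Weights of the point at distance `t` from `X` on the hyperboloid geodesic: `e1` and `e2` give
  -- the Lorentz products of `s X + u Y` with `X` and `Y`, and `e3` puts it on the hyperboloid.
  set s := Real.sinh (L - t) / Real.sinh L with hs
  set u := Real.sinh t / Real.sinh L with hu
  have hs0 : 0 ≤ s := div_nonneg (Real.sinh_nonneg_iff.2 (by linarith)) hS.le
  have hu0 : 0 ≤ u := div_nonneg (Real.sinh_nonneg_iff.2 ht) hS.le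
  have hx := one_sub_sq_pos x
  have hy := one_sub_sq_pos y
  set X₀ := (1 + ‖x.1‖ ^ 2) / (1 - ‖x.1‖ ^ 2) with hX₀
  set Y₀ := (1 + ‖y.1‖ ^ 2) / (1 - ‖y.1‖ ^ 2) with hY₀
  set X := (2 / (1 - ‖x.1‖ ^ 2)) • x.1 with hX
  set Y := (2 / (1 - ‖y.1‖ ^ 2)) • y.1 with hY
  have hX₀p : 0 < X₀ := by positivity
  have hY₀p : 0 < Y₀ := by positivity
  have hxx : X₀ ^ 2 - ‖X‖ ^ 2 = 1 := by
    rw [hX, norm_smul, Real.norm_of_nonneg (by positivity), hX₀]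
    field_simp
    ring
  have hyy : Y₀ ^ 2 - ‖Y‖ ^ 2 = 1 := by
    rw [hY, norm_smul, Real.norm_of_nonneg (by positivity), hY₀]
    field_simp
    ring
  have hxy : X₀ * Y₀ - inner ℝ X Y = Real.cosh L := (cosh_hdist_eq_lorentz x y).symm
  clear_value X Y X₀ Y₀
  have e1 : s + u * Real.cosh L = Real.cosh t := by
    rw [hs, hu, Real.sinh_sub]
    field_simp
    ring
  have e2 : s * Real.cosh L + u = Real.cosh (L - t) := by
    have := Real.cosh_sq L
    rw [hs, hu, Real.sinh_sub, Real.cosh_sub]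
    field_simp
    linear_combination (-Real.sinh t) * this
  have e3 : s * Real.cosh t + u * Real.cosh (L - t) = 1 := by
    have : Real.sinh L = Real.sinh (L - t + t) := by ring_nf
    rw [hs, hu]
    field_simp
    rw [this, Real.sinh_add]
    ring
  have hsum : 0 < s * X₀ + u * Y₀ := by
    rcases hs0.eq_or_lt with h | h
    · rcases hu0.eq_or_lt with h' | h'
      · rw [← h, ← h'] at e3; norm_num at e3
      · positivity
    · positivity
  have hP : (s * X₀ + u * Y₀) ^ 2 - ‖s • X + u • Y‖ ^ 2 = 1 := by
    rw [@norm_add_sq_real, inner_smul_left, inner_smul_right, norm_smul, norm_smul,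
      Real.norm_of_nonneg hs0, Real.norm_of_nonneg hu0]
    simp only [conj_trivial]
    rw [← e1, ← e2] at e3
    linear_combination e3 + s ^ 2 * hxx + u ^ 2 * hyy + 2 * s * u * hxy
  obtain ⟨p, hp1, hp2⟩ := exists_of_hyperboloid _ _ hsum hP
  set P₀ := s * X₀ + u * Y₀
  have hP₁ : 0 < 1 + P₀ := by linarith
  have hp3 : (1 + ‖p.1‖ ^ 2) / (1 - ‖p.1‖ ^ 2) = P₀ := by
    have : 1 + ‖p.1‖ ^ 2 = 2 - 2 / (1 + P₀) := by linarith
    rw [this, hp1]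
    field_simp
    ring
  have hp4 : (2 / (1 - ‖p.1‖ ^ 2)) • p.1 = s • X + u • Y := by
    rw [hp1, hp2, smul_smul]
    convert one_smul ℝ _ using 2
    field_simp
  have dxp : hdist x p = t := by
    have h := cosh_hdist_eq_lorentz x p
    rw [hp3, hp4, ← hX, ← hX₀, inner_add_right, inner_smul_right, inner_smul_right,
      real_inner_self_eq_norm_sq] at h
    have h' : Real.cosh (hdist x p) = Real.cosh t := by
      rw [h, ← e1]
      linear_combination s * hxx + u * hxy
    exact Real.cosh_strictMonoOn.injOn (hdist_nonneg x p) ht h'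
  have dpy : hdist y p = L - t := by
    have h := cosh_hdist_eq_lorentz y p
    rw [hp3, hp4, ← hY, ← hY₀, inner_add_right, inner_smul_right, inner_smul_right,
      real_inner_self_eq_norm_sq, real_inner_comm] at h
    have h' : Real.cosh (hdist y p) = Real.cosh (L - t) := by
      rw [h, ← e2]
      linear_combination s * hxy + u * hyy
    exact Real.cosh_strictMonoOn.injOn (hdist_nonneg y p)
      (by simpa using ht') h'
  refine ⟨p, ?_, dxp⟩
  change hdist x p + hdist p y = hdist x y
  rw [dxp, hdist_comm p y, dpy]
  ring

end Geodesics

/-! ### Gromov products -/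

section Gromov

variable {d : ℕ}

theorem gromov_nonneg (x y z : Hyp d) : 0 ≤ gromov x y z := by
  have := hdist_triangle x z y
  unfold gromov
  linarith

theorem gromov_comm (x y z : Hyp d) : gromov x y z = gromov y x z := by
  unfold gromov
  rw [hdist_comm x z, hdist_comm z y, hdist_comm x y]
  ring

theorem gromov_add_gromov (x y z : Hyp d) : gromov x y z + gromov z y x = hdist x z := by
  unfold gromov
  rw [hdist_comm z x]
  ring

theorem gromov_le_hdist (x y z : Hyp d) : gromov x y z ≤ hdist x z := by
  linarith [gromov_add_gromov x y z, gromov_nonneg z y x]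

/-- Gromov hyperbolicity in terms of Gromov products. -/
theorem min_gromov_le (x y z o : Hyp d) :
    min (gromov x y o) (gromov y z o) ≤ gromov x z o + 2 := by
  have h := four_point x z y o
  unfold gromov
  have h1 := hdist_comm z y
  have h2 := hdist_comm y o
  have h3 := hdist_comm z o
  have h4 := hdist_comm x o
  rcases le_total (hdist x y + hdist z o) (hdist x o + hdist z y) with h' | h'
  · rw [max_eq_right h'] at h
    refine (min_le_right _ _).trans ?_
    linarith
  · rw [max_eq_left h'] at h
    refine (min_le_left _ _).trans ?_
    linarith

/-- A segment `[x, y]` passes within `(x | y)_q + 4` of `q`. -/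
theorem exists_mem_geod_hdist_le (x y q : Hyp d) :
    ∃ p ∈ geod x y, hdist p q ≤ gromov x y q + 4 := by
  have hle : gromov y q x ≤ hdist x y := by
    rw [hdist_comm]; exact gromov_le_hdist y q x
  -- At distance `(y | q)_x` from `x` the two sums in the four-point inequality for `p, q, x, y` are
  -- equal.
  obtain ⟨p, hp, hxp⟩ := exists_mem_geod x y (gromov_nonneg y q x) hle
  refine ⟨p, hp, ?_⟩
  have hp' : hdist x p + hdist p y = hdist x y := hp
  have h := four_point p q x y
  have c1 := hdist_comm p x
  have c2 := hdist_comm q x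
  have c3 := hdist_comm y x
  have c4 := hdist_comm y q
  unfold gromov at hxp ⊢
  rcases le_total (hdist p x + hdist q y) (hdist p y + hdist q x) with h' | h'
  · rw [max_eq_right h'] at h
    linarith
  · rw [max_eq_left h'] at h
    linarith

end Gromov

/-! ### Extension of the Gromov product to the compactification -/

section Boundary

variable {d : ℕ}

/-- `|ζ - y| + √(|ζ - y|² + (1 - |ζ|²)(1 - |y|²))`, which is `e^{d(ζ, y)/2}` up to a factor
`√((1 - |ζ|²)(1 - |y|²))`. -/
noncomputable def expNum (ζ : HypBar d) (y : Hyp d) : ℝ :=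
  ‖ζ.1 - y.1‖ + Real.sqrt (‖ζ.1 - y.1‖ ^ 2 + (1 - ‖ζ.1‖ ^ 2) * (1 - ‖y.1‖ ^ 2))

theorem expNum_pos (ζ : HypBar d) (y : Hyp d) : 0 < expNum ζ y := by
  rcases eq_or_ne ζ.1 y.1 with h | h
  · have hy := one_sub_sq_pos y
    unfold expNum
    rw [h]
    refine add_pos_of_nonneg_of_pos (norm_nonneg _) (Real.sqrt_pos.2 ?_)
    positivity
  · exact add_pos_of_pos_of_nonneg (norm_pos_iff.2 (sub_ne_zero.2 h)) (Real.sqrt_nonneg _)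

theorem continuous_expNum (y : Hyp d) : Continuous fun ζ : HypBar d => expNum ζ y := by
  unfold expNum
  fun_prop

/-- Since `e^{d/2} = sinh (d/2) + cosh (d/2)`. The only term singular at the boundary, `log √(1 -
|w|²)`, does not depend on `y` and so cancels in Gromov products. -/
theorem hdist_eq_log (w y : Hyp d) : hdist w y = 2 * (Real.log (expNum (toBar w) y) -
    Real.log (Real.sqrt (1 - ‖w.1‖ ^ 2)) - Real.log (Real.sqrt (1 - ‖y.1‖ ^ 2))) := by
  have hw := Real.sqrt_pos.2 (one_sub_sq_pos w)
  have hy := Real.sqrt_pos.2 (one_sub_sq_pos y)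
  have h : Real.exp (hdist w y / 2) = expNum (toBar w) y /
      (Real.sqrt (1 - ‖w.1‖ ^ 2) * Real.sqrt (1 - ‖y.1‖ ^ 2)) := by
    rw [← Real.sinh_add_cosh, sinh_half_hdist, cosh_half_hdist, ← add_div]
    rfl
  have h2 : hdist w y / 2 = Real.log (expNum (toBar w) y /
      (Real.sqrt (1 - ‖w.1‖ ^ 2) * Real.sqrt (1 - ‖y.1‖ ^ 2))) := by rw [← h, Real.log_exp]
  rw [Real.log_div (expNum_pos _ _).ne' (by positivity), Real.log_mul hw.ne' hy.ne'] at h2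
  linarith

/-- The Gromov product `(ζ | y)_z` for `ζ ∈ ℍ^d ∪ ∂ℍ^d`, in closed form. -/
noncomputable def gromovExt (ζ : HypBar d) (y z : Hyp d) : ℝ :=
  Real.log (expNum ζ z) - Real.log (expNum ζ y) - Real.log (Real.sqrt (1 - ‖z.1‖ ^ 2)) +
    Real.log (Real.sqrt (1 - ‖y.1‖ ^ 2)) + hdist z y / 2

theorem continuous_gromovExt (y z : Hyp d) : Continuous fun ζ : HypBar d => gromovExt ζ y z := by
  unfold gromovExt
  have h1 := (continuous_expNum z).log fun ζ => (expNum_pos ζ z).ne'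
  have h2 := (continuous_expNum y).log fun ζ => (expNum_pos ζ y).ne'
  fun_prop

theorem gromovExt_toBar (w y z : Hyp d) : gromovExt (toBar w) y z = gromov w y z := by
  unfold gromovExt gromov
  rw [hdist_eq_log w z, hdist_eq_log w y]
  ring

theorem comap_toBar_nhds_neBot (ζ : HypBar d) :
    (comap (toBar : Hyp d → HypBar d) (𝓝 ζ)).NeBot := by
  refine comap_neBot fun t ht => ?_
  obtain ⟨u, hu, hut⟩ := mem_nhds_subtype _ _ _ |>.1 ht
  have hζ : ζ.1 ∈ closure (Metric.ball (0 : EuclideanSpace ℝ (Fin d)) 1) := by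
    rw [closure_ball _ one_ne_zero]
    exact ζ.2
  obtain ⟨v, hvu, hv⟩ := mem_closure_iff_nhds.1 hζ u hu
  exact ⟨⟨v, hv⟩, hut hvu⟩

theorem gromovBar_eq_gromovExt (ζ : HypBar d) (y z : Hyp d) :
    gromovBar ζ y z = gromovExt ζ y z := by
  have := comap_toBar_nhds_neBot ζ
  unfold gromovBar
  refine Tendsto.liminf_eq ?_
  simp only [← gromovExt_toBar]
  exact ((continuous_gromovExt y z).tendsto ζ).comp tendsto_comap

theorem isClosed_shadow (x₀ y : Hyp d) (r : ℝ) : IsClosed (shadow x₀ y r) := by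
  unfold shadow
  simp only [gromovBar_eq_gromovExt]
  exact isClosed_le (continuous_gromovExt _ _) continuous_const

theorem toBar_mem_shadow_iff (x₀ y w : Hyp d) (r : ℝ) :
    toBar w ∈ shadow x₀ y r ↔ gromov w x₀ y ≤ r := by
  simp only [shadow, Set.mem_ofPred_eq, gromovBar_eq_gromovExt, gromovExt_toBar]

/-- A shadow has an open neighbourhood inside any larger shadow. -/
theorem exists_open_between_shadows (x₀ y : Hyp d) {r s : ℝ} (h : r < s) :
    ∃ U : Set (HypBar d), IsOpen U ∧ shadow x₀ y r ⊆ U ∧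
      ∀ w : Hyp d, toBar w ∈ U → gromov w x₀ y ≤ s := by
  refine ⟨{ζ | gromovExt ζ x₀ y < s}, isOpen_lt (continuous_gromovExt _ _) continuous_const,
    fun ζ hζ => ?_, fun w hw => ?_⟩
  · simp only [shadow, Set.mem_ofPred_eq, gromovBar_eq_gromovExt] at hζ
    exact lt_of_le_of_lt hζ h
  · rw [Set.mem_ofPred_eq, gromovExt_toBar] at hw
    exact hw.le

end Boundary

/-! ### Chains -/

section Chains

variable {d : ℕ} {c D : ℝ}

theorem gromov_self_right (x y : Hyp d) : gromov x y y = 0 := by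
  simp [gromov, hdist_self]

theorem gromov_self_left (x y : Hyp d) : gromov x y x = 0 := by
  simp [gromov, hdist_self]

/-- Local-to-global step: a small angle at `y` stays small when `z` is replaced by a point `w`
which lies behind `z`. -/
theorem gromov_le_of_far {x y z w : Hyp d} {E E' : ℝ} (h : gromov x z y ≤ E)
    (h' : gromov y w z ≤ E') (hfar : E + E' + 2 < hdist y z) : gromov x w y ≤ E + 2 := by
  have h1 := gromov_add_gromov y w z
  have h2 := min_gromov_le x w z y
  rw [gromov_comm w z y] at h2
  -- The second alternative is impossible: `(w | z)_y = d(y, z) - (y | w)_z` exceeds `E + 2`.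
  rcases min_le_iff.1 h2 with h3 | h3 <;> linarith

theorem IsCDChain.shift {n : ℕ} {z : ℕ → Hyp d} (h : IsCDChain c D n z) {k m : ℕ}
    (hk : m + k ≤ n) : IsCDChain c D m fun i => z (i + k) := by
  refine ⟨fun i hi him => ?_, fun i hi => ?_⟩
  · have := h.1 (i + k) (by omega) (by omega)
    rwa [show i + k - 1 = i - 1 + k by omega, show i + k + 1 = i + 1 + k by omega] at this
  · have := h.2 (i + k) (by omega)
    rwa [show i + k + 1 = i + 1 + k by omega] at this

theorem IsCDChain.reverse {n : ℕ} {z : ℕ → Hyp d} (h : IsCDChain c D n z) :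
    IsCDChain c D n fun i => z (n - i) := by
  refine ⟨fun i hi him => ?_, fun i hi => ?_⟩
  · have := h.1 (n - i) (by omega) (by omega)
    rwa [gromov_comm, show n - i - 1 = n - (i + 1) by omega,
      show n - i + 1 = n - (i - 1) by omega] at this
  · have := h.2 (n - (i + 1)) (by omega)
    rwa [hdist_comm, show n - (i + 1) + 1 = n - i by omega] at this

/-- Two chains overlapping in an edge can be concatenated. -/
theorem IsCDChain.glue {p q : ℕ} {z w : ℕ → Hyp d} (hz : IsCDChain c D (p + 1) z)
    (hw : IsCDChain c D (q + 1) w) (h0 : z p = w 0) (h1 : z (p + 1) = w 1) :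
    IsCDChain c D (p + q + 1) fun i => if i ≤ p then z i else w (i - p) := by
  have hle : ∀ i, i ≤ p + 1 → (if i ≤ p then z i else w (i - p)) = z i := fun i hi => by
    split_ifs with h
    · rfl
    · rw [show i = p + 1 by omega, h1, Nat.add_sub_cancel_left]
  have hge : ∀ i, p ≤ i → (if i ≤ p then z i else w (i - p)) = w (i - p) := fun i hi => by
    split_ifs with h
    · rw [show i = p by omega, h0, Nat.sub_self]
    · rfl
  refine ⟨fun i hi hip => ?_, fun i hi => ?_⟩
  · rcases le_or_gt i p with h | h
    · simp only [hle (i - 1) (by omega), hle i (by omega), hle (i + 1) (by omega)]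
      exact hz.1 i hi (by omega)
    · simp only [hge (i - 1) (by omega), hge i (by omega), hge (i + 1) (by omega)]
      have := hw.1 (i - p) (by omega) (by omega)
      rwa [show i - p - 1 = i - 1 - p by omega, show i - p + 1 = i + 1 - p by omega] at this
  · rcases le_or_gt i p with h | h
    · simp only [hle i (by omega), hle (i + 1) (by omega)]
      exact hz.2 i (by omega)
    · simp only [hge i (by omega), hge (i + 1) (by omega)]
      have := hw.2 (i - p) (by omega)
      rwa [show i - p + 1 = i + 1 - p by omega] at this

/-- Induction on the tail from `z 1`. The error stays at `2` because each angle is derived afresh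
from the local bound `c`; the distance cannot drop below `D`, since adding an edge gains `D` and
loses at most `2(c + 2)`. -/
theorem IsCDChain.gromov_one_le (hc : 0 ≤ c) (hD : 2 * c + 6 < D) {n : ℕ} :
    ∀ {z : ℕ → Hyp d}, IsCDChain c D (n + 1) z →
      gromov (z 0) (z (n + 1)) (z 1) ≤ c + 2 ∧ D ≤ hdist (z 0) (z (n + 1)) := by
  induction n with
  | zero =>
    intro z hz
    refine ⟨?_, hz.2 0 (by omega)⟩
    rw [zero_add, gromov_self_right]
    linarith
  | succ n ih =>
    intro z hz
    obtain ⟨h1, h2⟩ := ih (z := fun i => z (i + 1)) (hz.shift (by omega))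
    have h3 := hz.1 1 one_pos (by omega)
    have h4 := hz.2 0 (by omega)
    have h5 := hz.2 1 (by omega)
    simp only [zero_add, Nat.sub_self, Nat.reduceAdd] at h1 h2 h3 h4 h5
    have h6 : gromov (z 0) (z (n + 1 + 1)) (z 1) ≤ c + 2 :=
      gromov_le_of_far h3 h1 (by linarith)
    refine ⟨h6, ?_⟩
    unfold gromov at h6
    linarith

/-- Chains are quasi-geodesics: their endpoints see each intermediate point under a large angle. -/
theorem IsCDChain.gromov_le (hc : 0 ≤ c) (hD : 2 * c + 6 < D) {n : ℕ} {z : ℕ → Hyp d}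
    (hz : IsCDChain c D n z) {i : ℕ} (hi : i ≤ n) : gromov (z 0) (z n) (z i) ≤ c + 4 := by
  rcases Nat.eq_zero_or_pos i with rfl | hpos
  · rw [gromov_self_left]; linarith
  rcases hi.eq_or_lt with rfl | hlt
  · rw [gromov_self_right]; linarith
  obtain ⟨j, rfl⟩ : ∃ j, i = j + 1 := ⟨i - 1, by omega⟩
  obtain ⟨k, rfl⟩ : ∃ k, n = k + 1 + j := ⟨n - 1 - j, by omega⟩
  -- The chain is followed forwards from `z j` and backwards from `z (j + 1)`. Both angles are at
  -- most `c + 2`, and joining them along the common edge requires `2(c + 2) + 2 < D`.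
  have hA := ((hz.shift (k := j) (m := k + 1) le_rfl).gromov_one_le hc hD).1
  have hB := ((hz.shift (k := 0) (m := j + 1) (by omega)).reverse.gromov_one_le hc hD).1
  simp only [zero_add, add_zero, Nat.sub_zero, Nat.sub_self, Nat.add_sub_cancel] at hA hB
  rw [add_comm 1 j, gromov_comm] at hA
  have hd := hz.2 j (by omega)
  have h := gromov_le_of_far (x := z (k + 1 + j)) (z := z j) (w := z 0) (y := z (j + 1))
    hA hB (by rw [hdist_comm]; linarith)
  rw [gromov_comm]
  linarith

end Chains

/-! ### Property (A) and words -/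

section Isometric

variable {d : ℕ} {Γ : Type*} [Group Γ] [MulAction Γ (Hyp d)]
  (hiso : ∀ (g : Γ) (x y : Hyp d), hdist (g • x) (g • y) = hdist x y) {x₀ : Hyp d} {a u v : Γ}

include hiso

theorem gromov_smul (g : Γ) (x y z : Hyp d) :
    gromov (g • x) (g • y) (g • z) = gromov x y z := by
  simp only [gromov, hiso]

theorem hdist_inv_smul (g : Γ) (x y : Hyp d) : hdist (g⁻¹ • x) y = hdist x (g • y) := by
  rw [← hiso g, smul_inv_smul]

theorem hdist_smul_mul (g h : Γ) (x₀ : Hyp d) :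
    hdist (g • x₀) ((g * h) • x₀) = len x₀ h := by
  rw [mul_smul, hiso, len]

theorem len_mul_le (g h : Γ) : len x₀ (g * h) ≤ len x₀ g + len x₀ h := by
  have := hdist_triangle x₀ (g • x₀) ((g * h) • x₀)
  rwa [hdist_smul_mul hiso] at this

theorem len_inv (g : Γ) : len x₀ g⁻¹ = len x₀ g := by
  rw [len, hdist_comm, hdist_inv_smul hiso, len]

theorem IsCDChain.smul {c D : ℝ} {n : ℕ} {z : ℕ → Hyp d} (h : IsCDChain c D n z) (g : Γ) :
    IsCDChain c D n fun i => g • z i :=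
  ⟨fun i hi hin => by simpa only [gromov_smul hiso] using h.1 i hi hin,
    fun i hi => by simpa only [hiso] using h.2 i hi⟩

/-- Elements with property (A) are closed under `(u, v) ↦ u a v`. -/
theorem PropertyA.mul (hu : PropertyA x₀ a u) (hv : PropertyA x₀ a v) :
    PropertyA x₀ a (u * a * v) := by
  obtain ⟨n, w, hn, w0, w1, wn, wn', hw⟩ := hu
  obtain ⟨m, w', hm, w0', w1', wm, wm', hw'⟩ := hv
  -- The last edge of the chain of `u` is the first edge of the chain of `v` translated by `u a`.
  have e0 : w (n + 1) = (u * a) • w' 0 := by rw [wn, w0', mul_smul, smul_inv_smul]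
  have e1 : w (n + 1 + 1) = (u * a) • w' 1 := by rw [w1', ← wn']
  refine ⟨n + 1 + m, _, by omega, ?_, ?_, ?_, ?_, hw.glue (hw'.smul hiso (u * a)) e0 e1⟩
  · simpa using w0
  · simpa using w1
  · simp only [show ¬ n + 1 + m + 1 ≤ n + 1 by omega, if_false,
      show n + 1 + m + 1 - (n + 1) = m + 1 by omega, wm, mul_smul]
  · simp only [show ¬ n + 1 + m + 2 ≤ n + 1 by omega, if_false,
      show n + 1 + m + 2 - (n + 1) = m + 2 by omega, wm', mul_smul]

variable (ha : 3 * 10 ^ 6 < len x₀ a)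

include ha

omit hiso in
theorem PropertyA.le_len (hu : PropertyA x₀ a u) : len x₀ a ≤ len x₀ u := by
  obtain ⟨n, w, hn, w0, w1, wn, wn', hw⟩ := hu
  obtain ⟨k, rfl⟩ : ∃ k, n = k + 1 := ⟨n - 1, by omega⟩
  have := ((hw.shift (k := 1) (m := k + 1) (by omega)).gromov_one_le
    (by linarith) (by linarith)).2
  simp only [zero_add, w1, wn] at this
  exact this

omit hiso in
theorem PropertyA.gromov_inv_le (hu : PropertyA x₀ a u) :
    gromov (a⁻¹ • x₀) (u • x₀) x₀ ≤ 3 * (len x₀ a / 10 ^ 6) := by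
  obtain ⟨n, w, hn, w0, w1, wn, wn', hw⟩ := hu
  have := (hw.shift (k := 0) (m := n + 1) (by omega)).gromov_le
    (by linarith) (by linarith) (i := 1) (by omega)
  simp only [add_zero, w0, w1, wn] at this
  linarith

omit hiso in
theorem PropertyA.gromov_le_aux (hu : PropertyA x₀ a u) :
    gromov x₀ ((u * a) • x₀) (u • x₀) ≤ len x₀ a / 10 ^ 6 + 4 := by
  obtain ⟨n, w, hn, w0, w1, wn, wn', hw⟩ := hu
  have := (hw.shift (k := 1) (m := n + 1) (by omega)).gromov_le
    (by linarith) (by linarith) (i := n) (by omega)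
  simpa only [zero_add, w1, wn, wn', Nat.add_assoc, Nat.reduceAdd] using this

/-- The chain of `u` controls the angle at `u x₀` towards `u a x₀`, and the translated chain of `v`
the angle at `u a x₀`; the edge between them is long. With `c = ‖a‖ / 10⁶ > 3` the resulting `c + 6`
is at most `3c`. -/
theorem PropertyA.gromov_le (hu : PropertyA x₀ a u) (hv : PropertyA x₀ a v) :
    gromov x₀ ((u * a * v) • x₀) (u • x₀) ≤ 3 * (len x₀ a / 10 ^ 6) := by
  have h1 := hu.gromov_le_aux ha
  have h2 := hv.gromov_inv_le ha
  rw [← gromov_smul hiso (u * a), ← mul_smul, ← mul_smul, mul_inv_cancel_right] at h2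
  have := gromov_le_of_far h1 h2 (by rw [hdist_smul_mul hiso]; linarith)
  linarith

theorem PropertyA.len_mul_ge (hu : PropertyA x₀ a u) (hv : PropertyA x₀ a v) :
    len x₀ u + len x₀ v + len x₀ a * (9 / 10) ≤ len x₀ (u * a * v) := by
  have h1 := hu.gromov_le hiso ha hv
  have h2 := hv.gromov_inv_le ha
  unfold gromov at h1 h2
  rw [mul_assoc u, hdist_smul_mul hiso] at h1
  rw [hdist_inv_smul hiso, hdist_inv_smul hiso, ← mul_smul] at h2
  unfold len at *
  rw [mul_assoc]
  linarith

end Isometric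

/-! ### Words in an alphabet -/

section Words

variable {Γ : Type*} [Group Γ] {a : Γ} {A B : Set Γ}

theorem mem_wordSet_of_mem {g : Γ} (hg : g ∈ A) : g ∈ wordSet a A :=
  ⟨[g], by simp, by simpa using hg, rfl⟩

theorem mul_mem_wordSet {g v : Γ} (hg : g ∈ A) (hv : v ∈ wordSet a A) :
    g * a * v ∈ wordSet a A := by
  obtain ⟨l, hl, hA, rfl⟩ := hv
  obtain ⟨h, l, rfl⟩ := List.exists_cons_of_ne_nil hl
  exact ⟨g :: h :: l, by simp, List.forall_mem_cons.2 ⟨hg, hA⟩, rfl⟩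

theorem wordSet_induction {p : Γ → Prop} (base : ∀ g ∈ A, p g)
    (step : ∀ g ∈ A, ∀ v ∈ wordSet a A, p v → p (g * a * v)) : ∀ u ∈ wordSet a A, p u := by
  rintro u ⟨l, hl, hA, rfl⟩
  induction l with
  | nil => exact absurd rfl hl
  | cons g l ih =>
    obtain ⟨hg, hA⟩ := List.forall_mem_cons.1 hA
    cases l with
    | nil => exact base g hg
    | cons h l => exact step g hg _ ⟨h :: l, by simp, hA, rfl⟩ (ih (by simp) hA)

theorem wordSet_cases {u : Γ} (hu : u ∈ wordSet a A) :
    u ∈ A ∨ ∃ g ∈ A, ∃ v ∈ wordSet a A, u = g * a * v :=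
  wordSet_induction (p := fun u => u ∈ A ∨ ∃ g ∈ A, ∃ v ∈ wordSet a A, u = g * a * v)
    (fun _ hg => Or.inl hg) (fun g hg v hv _ => Or.inr ⟨g, hg, v, hv, rfl⟩) u hu

theorem wordSet_mul_mem {u v : Γ} (hu : u ∈ wordSet a A) (hv : v ∈ wordSet a A) :
    u * a * v ∈ wordSet a A := by
  refine wordSet_induction (p := fun u => u * a * v ∈ wordSet a A)
    (fun g hg => mul_mem_wordSet hg hv) (fun g hg w _ ih => ?_) u hu
  have := mul_mem_wordSet hg ih
  simpa only [mul_assoc] using this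

theorem wordSet_mono (h : A ⊆ B) : wordSet a A ⊆ wordSet a B := by
  rintro u ⟨l, hl, hA, rfl⟩
  exact ⟨l, hl, fun g hg => h (hA g hg), rfl⟩

end Words

section

variable {d : ℕ} {Γ : Type*} [Group Γ] [MulAction Γ (Hyp d)]

theorem len_nonneg (x₀ : Hyp d) (g : Γ) : 0 ≤ len x₀ g := hdist_nonneg _ _

theorem len_one (x₀ : Hyp d) : len x₀ (1 : Γ) = 0 := by
  rw [len, one_smul, hdist_self]

theorem critExp_nonneg (x₀ : Hyp d) (A : Set Γ) : 0 ≤ critExp x₀ A :=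
  Real.sInf_nonneg fun _ hs => hs.1

end

/-! ### Words in `F` are determined by their geometry -/

namespace Choices

variable {d : ℕ} {Γ : Type*} [Group Γ] [MulAction Γ (Hyp d)]

/-- `K ∪ {φ₁, φ₂, …}`. -/
def letters {Γ : Type*} [Group Γ] (D : Choices Γ) : Set Γ :=
  D.K ∪ {g | ∃ k, 1 ≤ k ∧ g = D.letter k}

/-- `g` starts with the letter `l`. -/
def HasHead {Γ : Type*} [Group Γ] (D : Choices Γ) (l g : Γ) : Prop :=
  l ∈ D.letters ∧ (g = l ∨ ∃ v ∈ D.F, g = l * D.a * v)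

theorem exists_hasHead {Γ : Type*} [Group Γ] {D : Choices Γ} {g : Γ} (hg : g ∈ D.F) :
    ∃ l, D.HasHead l g := by
  rcases wordSet_cases hg with h | ⟨l, hl, v, hv, h⟩
  · exact ⟨g, h, Or.inl rfl⟩
  · exact ⟨l, hl, Or.inr ⟨v, hv, h⟩⟩

namespace IsAdmissible

variable {D : Choices Γ} {x₀ : Hyp d}

theorem lt_len_a (hD : D.IsAdmissible x₀) : 3 * 10 ^ 6 < len x₀ D.a := by
  have h := le_ciSup hD.bddAbove (0, 0)
  have h' := gromov_nonneg ((D.a ^ (0 : ℤ)) • x₀) ((D.b ^ (0 : ℤ)) • x₀) x₀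
  have h1 := hD.le_a
  have h2 := hD.lt_b
  linarith

theorem C_pos (hD : D.IsAdmissible x₀) : 3000 < D.C x₀ := by
  have := hD.lt_len_a
  unfold Choices.C
  linarith

theorem len_b_le (hD : D.IsAdmissible x₀) : len x₀ D.b ≤ D.C x₀ := by
  have := hD.le_a
  unfold Choices.C
  linarith

theorem ε_mul_R_zero (hD : D.IsAdmissible x₀) : 10 ^ 7 * D.C x₀ < D.ε * D.R 0 := by
  obtain ⟨r₀, hr₀, -, h⟩ := hD.R_zero
  have hδ := critExp_nonneg x₀ (Set.univ : Set Γ)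
  have hC := hD.C_pos
  set δ := critExp x₀ (Set.univ : Set Γ)
  by_contra! hle
  have h1 : δ * (D.ε * D.R 0) ≤ δ * (10 ^ 7 * D.C x₀) := mul_le_mul_of_nonneg_left hle hδ
  have h2 : 0 ≤ r₀ * δ := by positivity
  nlinarith

theorem R_pos (hD : D.IsAdmissible x₀) (k : ℕ) : 0 < D.R k := by
  induction k with
  | zero =>
    have h1 := hD.ε_mul_R_zero
    have h2 := hD.C_pos
    exact pos_of_mul_pos_right (by linarith : 0 < D.ε * D.R 0) hD.ε_pos.le
  | succ k ih =>
    have := hD.R_succ (k + 1) (by omega)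
    rw [Nat.add_sub_cancel] at this
    linarith

theorem K_propertyA (hD : D.IsAdmissible x₀) {g : Γ} (hg : g ∈ D.K) : PropertyA x₀ D.a g := by
  obtain ⟨⟨-, ⟨h, rfl⟩⟩, -⟩ := hD.K_max.prop.1 hg
  exact hD.Φ_prop h

/-- The annulus has thickness `0.003 ε R₀` and the separation is `0.004 ε R₀`; the difference `0.001
ε R₀` exceeds `10⁴ C`. -/
theorem K_separated (hD : D.IsAdmissible x₀) {g h : Γ} (hg : g ∈ D.K) (hh : h ∈ D.K)
    (hne : g ≠ h) : |len x₀ g - len x₀ h| + 1000 * D.C x₀ ≤ hdist (g • x₀) (h • x₀) := by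
  obtain ⟨⟨g1, -⟩, g2⟩ := hD.K_max.prop.1 hg
  obtain ⟨⟨h1, -⟩, h2⟩ := hD.K_max.prop.1 hh
  have hsep := hD.K_max.prop.2 g hg h hh hne
  have hεR := hD.ε_mul_R_zero
  have hC := hD.C_pos
  simp only [ballOf, Set.mem_ofPred_eq, not_lt] at g1 g2 h1 h2
  have : |len x₀ g - len x₀ h| ≤ 0.003 * (D.ε * D.R 0) := by
    rw [abs_le]
    constructor <;> linarith
  linarith

theorem Φ_exc (hD : D.IsAdmissible x₀) {k : ℕ} (hk : 1 ≤ k) : ∃ β β' : Γ,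
    D.Φ (D.exc k) = β * D.exc k * β' ∧ len x₀ β ≤ D.C x₀ ∧ len x₀ β' ≤ D.C x₀ := by
  have hfar := hD.exc_far k hk
  have hR := hD.R_pos k
  have hC := hD.C_pos
  have hb := hD.len_b_le
  have h1 : len x₀ (1 : Γ) ≤ D.C x₀ := by rw [len_one]; linarith
  simp only [ballOf, Set.mem_ofPred_eq, not_lt] at hfar
  have ha : len x₀ D.a = 1000 * D.C x₀ := by unfold Choices.C; ring
  rcases hD.Φ_mem (D.exc k) (by linarith) with h | h | h | h
  · exact ⟨1, 1, by simpa using h, h1, h1⟩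
  · exact ⟨D.b, 1, by simpa using h, hb, h1⟩
  · exact ⟨1, D.b, by simpa using h, h1, hb⟩
  · exact ⟨D.b, D.b, h, hb, hb⟩

variable (hiso : ∀ (g : Γ) (x y : Hyp d), hdist (g • x) (g • y) = hdist x y)

include hiso

theorem le_len_Φ_exc (hD : D.IsAdmissible x₀) {k : ℕ} (hk : 1 ≤ k) :
    D.R k ≤ len x₀ (D.Φ (D.exc k)) := by
  obtain ⟨β, β', h, h1, h2⟩ := hD.Φ_exc hk
  have hfar := hD.exc_far k hk
  have hC := hD.C_pos
  simp only [ballOf, Set.mem_ofPred_eq, not_lt] at hfar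
  have e : D.exc k = β⁻¹ * D.Φ (D.exc k) * β'⁻¹ := by rw [h]; group
  have l1 := len_mul_le hiso (x₀ := x₀) (β⁻¹ * D.Φ (D.exc k)) β'⁻¹
  have l2 := len_mul_le hiso (x₀ := x₀) β⁻¹ (D.Φ (D.exc k))
  rw [← e] at l1
  rw [len_inv hiso] at l1 l2
  linarith

theorem letter_propertyA (hD : D.IsAdmissible x₀) (k : ℕ) : PropertyA x₀ D.a (D.letter k) :=
  (hD.Φ_prop _).mul hiso (hD.Φ_prop _)

theorem letters_propertyA (hD : D.IsAdmissible x₀) {g : Γ} (hg : g ∈ D.letters) :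
    PropertyA x₀ D.a g := by
  rcases hg with hg | ⟨k, -, rfl⟩
  · exact hD.K_propertyA hg
  · exact hD.letter_propertyA hiso k

theorem F_propertyA (hD : D.IsAdmissible x₀) : ∀ g ∈ D.F, PropertyA x₀ D.a g :=
  wordSet_induction (fun _ hg => hD.letters_propertyA hiso hg)
    fun _ hg _ _ hv => (hD.letters_propertyA hiso hg).mul hiso hv

/-- No orbit point of moderate length lies near the initial part of a geodesic through
`Φ(ϕ_k) x₀`. -/
theorem excursion_avoids (hD : D.IsAdmissible x₀) {k : ℕ} (hk : 1 ≤ k) {γ : Γ} {P : Hyp d}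
    (h1 : len x₀ D.a ≤ len x₀ γ) (h2 : len x₀ γ < D.R k - 10 ^ 4 * D.C x₀)
    (hP : gromov x₀ P (D.Φ (D.exc k) • x₀) ≤ D.C x₀ / 100)
    (hq : gromov x₀ P (γ • x₀) ≤ 9 * D.C x₀) : False := by
  obtain ⟨β, β', hΦ, hβ, hβ'⟩ := hD.Φ_exc hk
  obtain ⟨x, y, hx, hy, hxy⟩ := hD.exc_mem k hk
  have hlen := hD.le_len_Φ_exc hiso hk
  have hC := hD.C_pos
  have ha : len x₀ D.a = 1000 * D.C x₀ := by unfold Choices.C; ring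
  set f := D.Φ (D.exc k)
  set C := D.C x₀
  -- Translation by `β` moves the excursion of `ϕ_k` to one for `Φ(ϕ_k)`, at the cost of one more
  -- `C` at each end.
  have hX : hdist (β • x) x₀ ≤ 11 * C := by
    have := hdist_triangle (β • x) (β • x₀) x₀
    rw [hiso, hdist_comm (β • x₀)] at this
    unfold len at hβ
    linarith
  have hY : hdist (β • y) (f • x₀) ≤ 11 * C := by
    have := hdist_triangle (β • y) (β • D.exc k • x₀) (f • x₀)
    rw [hiso, hΦ, ← mul_smul, hdist_smul_mul hiso] at this
    rw [hΦ]
    linarith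
  -- `γ x₀` is near `[x₀, P]` and `‖γ‖` is below `‖f‖`, so `γ x₀` is near `[x₀, f x₀]`. It is far
  -- from both ends (`far1`, `far2`), so these may be replaced by `β x` and `β y`.
  have hxY : gromov (β • x) (β • y) (γ • x₀) ≤ 9 * C + 10 := by
    unfold len at h1 h2 hlen ha
    have g1 := gromov_add_gromov x₀ P (γ • x₀)
    have g2 := gromov_add_gromov x₀ P (f • x₀)
    have m1 := min_gromov_le (γ • x₀) P (f • x₀) x₀
    rw [gromov_comm P] at m1
    have g3 : hdist x₀ (γ • x₀) - 9 * C - 2 ≤ gromov (γ • x₀) (f • x₀) x₀ := by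
      rcases min_le_iff.1 m1 with h | h <;> linarith
    have g4 := gromov_add_gromov x₀ (f • x₀) (γ • x₀)
    have m2 := min_gromov_le x₀ (β • x) (f • x₀) (γ • x₀)
    have m3 := min_gromov_le (β • x) (β • y) (f • x₀) (γ • x₀)
    have t1 := hdist_triangle x₀ (β • x) (γ • x₀)
    have t2 := hdist_triangle (γ • x₀) (β • y) (f • x₀)
    have t3 := hdist_triangle x₀ (γ • x₀) (f • x₀)
    have c1 := hdist_comm (β • x) x₀
    have far1 : 100 * C ≤ gromov x₀ (β • x) (γ • x₀) := by
      unfold gromov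
      have := hdist_comm (β • x) (γ • x₀)
      linarith
    have far2 : 100 * C ≤ gromov (β • y) (f • x₀) (γ • x₀) := by
      unfold gromov
      have := hdist_comm (β • y) (γ • x₀)
      linarith
    rcases min_le_iff.1 m2 with h | h
    · linarith
    · rcases min_le_iff.1 m3 with h' | h' <;> linarith
  -- This point is within `9 C + 14 < 10 C` of the orbit, against the choice of the excursion.
  obtain ⟨p, hp, hpq⟩ := exists_mem_geod_hdist_le (β • x) (β • y) (γ • x₀)
  have hp' : β⁻¹ • p ∈ geod x y := by
    have : hdist (β • x) p + hdist p (β • y) = hdist (β • x) (β • y) := hp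
    change hdist x (β⁻¹ • p) + hdist (β⁻¹ • p) y = hdist x y
    rw [hdist_comm x, hdist_inv_smul hiso, hdist_inv_smul hiso, hdist_comm p (β • x), this, hiso]
  have hfin := hxy _ hp' (β⁻¹ * γ)
  rw [mul_smul, hiso] at hfin
  linarith

theorem gromov_head_le (hD : D.IsAdmissible x₀) {l g : Γ} (h : D.HasHead l g) :
    gromov x₀ (g • x₀) (l • x₀) ≤ D.C x₀ / 100 := by
  have hC := hD.C_pos
  have ha : len x₀ D.a = 1000 * D.C x₀ := by unfold Choices.C; ring
  obtain ⟨hl, rfl | ⟨v, hv, rfl⟩⟩ := h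
  · rw [gromov_self_right]; linarith
  · have := (hD.letters_propertyA hiso hl).gromov_le hiso hD.lt_len_a (hD.F_propertyA hiso v hv)
    linarith

/-- A word starting with `φ_k` has the form `Φ(ϕ_k) a v` with `v` of property (A). -/
theorem gromov_exc_le (hD : D.IsAdmissible x₀) {k : ℕ} {g : Γ} (h : D.HasHead (D.letter k) g) :
    gromov x₀ (g • x₀) (D.Φ (D.exc k) • x₀) ≤ D.C x₀ / 100 := by
  have hC := hD.C_pos
  have ha : len x₀ D.a = 1000 * D.C x₀ := by unfold Choices.C; ring
  obtain ⟨hl, rfl | ⟨v, hv, rfl⟩⟩ := h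
  · have := (hD.Φ_prop (D.exc k)).gromov_le hiso hD.lt_len_a (hD.Φ_prop (D.enum k))
    unfold letter
    linarith
  · have := (hD.Φ_prop (D.exc k)).gromov_le hiso hD.lt_len_a
      ((hD.Φ_prop (D.enum k)).mul hiso (hD.F_propertyA hiso v hv))
    simp only [letter, mul_assoc] at this ⊢
    linarith

theorem R_le_len_letter (hD : D.IsAdmissible x₀) {k : ℕ} (hk : 1 ≤ k) :
    D.R k ≤ len x₀ (D.letter k) := by
  have h1 := (hD.Φ_prop (D.exc k)).len_mul_ge hiso hD.lt_len_a (hD.Φ_prop (D.enum k))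
  have h2 := hD.le_len_Φ_exc hiso hk
  have h3 := len_nonneg x₀ D.a
  have h4 := len_nonneg x₀ (D.Φ (D.enum k))
  unfold letter
  linarith

/-- If `g x₀` lies near `[x₀, h x₀]` then `g` and `h` start with the same letter. -/
theorem head_eq (hD : D.IsAdmissible x₀) {l m g h : Γ} (hg : D.HasHead l g)
    (hh : D.HasHead m h) (hgh : gromov (h • x₀) x₀ (g • x₀) ≤ 8.6 * D.C x₀) : l = m := by
  have hC := hD.C_pos
  have hlg := hD.gromov_head_le hiso hg
  have hmh := hD.gromov_head_le hiso hh
  have lg := gromov_add_gromov x₀ (g • x₀) (l • x₀)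
  have mh := gromov_add_gromov x₀ (h • x₀) (m • x₀)
  have gh := gromov_add_gromov x₀ (h • x₀) (g • x₀)
  rw [gromov_comm x₀ (h • x₀)] at gh
  have hl_le : hdist x₀ (l • x₀) ≤ hdist x₀ (g • x₀) + D.C x₀ / 50 := by
    have := hdist_nonneg (l • x₀) (g • x₀)
    unfold gromov at hlg
    linarith
  by_contra hne
  -- If `g` starts with `φ_k` and `m` is an earlier letter, then `m x₀` is near `[x₀, h x₀]` and
  -- nearer to `x₀` than `g x₀`, hence within reach of `[x₀, g x₀]`, which `excursion_avoids`
  -- forbids. `excl2` exchanges the roles.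
  have excl1 : ∀ k, 1 ≤ k → l = D.letter k → m ∈ D.alphabet k → False := by
    rintro k hk rfl hm
    have hs : len x₀ m < _ := hD.R_ball k hk hm
    have hR := hD.R_le_len_letter hiso hk
    refine hD.excursion_avoids hiso hk ((hD.letters_propertyA hiso hh.1).le_len hD.lt_len_a) hs
      (hD.gromov_exc_le hiso hg) ?_
    have mg := gromov_add_gromov x₀ (g • x₀) (m • x₀)
    have m1 := min_gromov_le (m • x₀) (h • x₀) (g • x₀) x₀
    rw [gromov_comm (h • x₀) (g • x₀)] at m1
    unfold len at *
    rcases min_le_iff.1 m1 with h | h <;> linarith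
  have excl2 : ∀ k, 1 ≤ k → m = D.letter k → l ∈ D.alphabet k → False := by
    rintro k hk rfl hm
    have hs : len x₀ l < _ := hD.R_ball k hk hm
    refine hD.excursion_avoids hiso hk ((hD.letters_propertyA hiso hg.1).le_len hD.lt_len_a) hs
      (hD.gromov_exc_le hiso hh) ?_
    have lh := gromov_add_gromov x₀ (h • x₀) (l • x₀)
    have m1 := min_gromov_le (l • x₀) (g • x₀) (h • x₀) x₀
    unfold len at *
    rcases min_le_iff.1 m1 with h | h <;> linarith
  rcases hg.1 with hl | ⟨j, hj, rfl⟩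
  · rcases hh.1 with hm | ⟨k, hk, rfl⟩
    -- Both `l x₀` and `m x₀` lie near `[x₀, h x₀]`, so their distance is nearly the difference of
    -- their lengths.
    · have hsep := hD.K_separated hl hm hne
      have m1 := min_gromov_le (l • x₀) (g • x₀) (h • x₀) x₀
      have m2 := min_gromov_le (l • x₀) (h • x₀) (m • x₀) x₀
      rw [gromov_comm (h • x₀) (m • x₀)] at m2
      have e : gromov (l • x₀) (m • x₀) x₀ =
        (len x₀ l + len x₀ m - hdist (l • x₀) (m • x₀)) / 2 := by
        unfold gromov len
        rw [hdist_comm _ x₀]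
      have ab1 := le_abs_self (len x₀ l - len x₀ m)
      have ab2 := neg_abs_le (len x₀ l - len x₀ m)
      unfold len at *
      rcases min_le_iff.1 m2 with h | h
      · rcases min_le_iff.1 m1 with h' | h' <;> linarith
      · linarith
    · exact excl2 k hk rfl (Or.inl hl)
  · rcases hh.1 with hm | ⟨k, hk, rfl⟩
    · exact excl1 j hj rfl (Or.inl hm)
    · rcases lt_trichotomy j k with hjk | rfl | hjk
      · exact excl2 k hk rfl (Or.inr ⟨j, hj, hjk, rfl⟩)
      · exact hne rfl
      · exact excl1 j hj rfl (Or.inr ⟨k, hk, hjk, rfl⟩)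

/-- If `q g x₀` lies near `[x₀, q h x₀]`, where `q` is empty or a prefix, then `g` is a prefix
of `h`. -/
theorem prefix_of_gromov_le (hD : D.IsAdmissible x₀) : ∀ g ∈ D.F, ∀ q : Γ,
    (q = 1 ∨ ∃ u ∈ D.F, q = u * D.a) → ∀ h ∈ D.F,
    gromov ((q * h) • x₀) x₀ ((q * g) • x₀) ≤ 8.5 * D.C x₀ →
      h = g ∨ ∃ v ∈ D.F, h = g * D.a * v := by
  have hC := hD.C_pos
  have ha : len x₀ D.a = 1000 * D.C x₀ := by unfold Choices.C; ring
  -- The induction keeps the hypothesis for the full words `q g`, `q h`, so errors do not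
  -- accumulate; removing `q` costs a fixed small multiple of `C`, taking `8.5 C` to `8.6 C`.
  have local_bound : ∀ q : Γ, (q = 1 ∨ ∃ u ∈ D.F, q = u * D.a) → ∀ g ∈ D.F, ∀ h : Γ,
      gromov ((q * h) • x₀) x₀ ((q * g) • x₀) ≤ 8.5 * D.C x₀ →
      gromov (h • x₀) x₀ (g • x₀) ≤ 8.6 * D.C x₀ := by
    intro q hq g hg h hgh
    have hA := hD.F_propertyA hiso g hg
    have hsmall : hdist x₀ (q • x₀) + len x₀ g - D.C x₀ / 10 ≤ hdist x₀ ((q * g) • x₀) := by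
      rcases hq with rfl | ⟨u, hu, rfl⟩
      · simp only [one_smul, one_mul, hdist_self, len]
        linarith
      · have h1 := (hD.F_propertyA hiso u hu).gromov_le hiso hD.lt_len_a hA
        have h2 := hA.gromov_inv_le hD.lt_len_a
        have h3 := len_mul_le hiso (x₀ := x₀) u D.a
        unfold gromov at h1 h2
        rw [mul_assoc u, hdist_smul_mul hiso] at h1
        rw [hdist_inv_smul hiso, hdist_inv_smul hiso, ← mul_smul] at h2
        unfold len at *
        rw [mul_assoc]
        linarith
    have htri := hdist_triangle x₀ (q • x₀) ((q * h) • x₀)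
    rw [hdist_smul_mul hiso] at htri
    unfold gromov at hgh ⊢
    rw [mul_smul q h, mul_smul q g, hiso, ← mul_smul, ← mul_smul, hdist_comm _ x₀,
      hdist_comm _ x₀] at hgh
    rw [hdist_comm (g • x₀) x₀, hdist_comm (h • x₀) x₀]
    unfold len at *
    linarith
  refine wordSet_induction (fun g hg q hq h hh hgh => ?_) (fun l hl g hg ih q hq h hh hgh => ?_)
  · have hb := local_bound q hq g (mem_wordSet_of_mem hg) h hgh
    obtain ⟨m, hm⟩ := exists_hasHead hh
    obtain rfl := hD.head_eq hiso ⟨hg, Or.inl rfl⟩ hm hb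
    exact hm.2
  · have hF : l * D.a * g ∈ D.F := mul_mem_wordSet hl hg
    have hb := local_bound q hq _ hF h hgh
    obtain ⟨m, hm⟩ := exists_hasHead hh
    obtain rfl := hD.head_eq hiso ⟨hl, Or.inr ⟨g, hg, rfl⟩⟩ hm hb
    obtain ⟨-, rfl | ⟨v, hv, rfl⟩⟩ := hm
    -- Here `h` is a single letter and a proper prefix of the other word, hence shorter by at least
    -- `900 C`.
    · exfalso
      have h1 := (hD.letters_propertyA hiso hl).len_mul_ge hiso hD.lt_len_a
        (hD.F_propertyA hiso g hg)
      have h2 := hdist_nonneg (h • x₀) ((h * D.a * g) • x₀)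
      have h3 := hdist_triangle x₀ (h • x₀) ((h * D.a * g) • x₀)
      have h4 := len_nonneg x₀ g
      unfold gromov at hb
      rw [hdist_comm (h • x₀) x₀, hdist_comm _ x₀] at hb
      unfold len at *
      linarith
    · have hq' : q * (l * D.a) = 1 ∨ ∃ u ∈ D.F, q * (l * D.a) = u * D.a := by
        right
        rcases hq with rfl | ⟨u, hu, rfl⟩
        · exact ⟨l, mem_wordSet_of_mem hl, one_mul _⟩
        · exact ⟨u * D.a * l, wordSet_mul_mem hu (mem_wordSet_of_mem hl), by group⟩
      have := ih _ hq' v hv (by simpa only [mul_assoc] using hgh)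
      rcases this with rfl | ⟨w, hw, rfl⟩
      · exact Or.inl rfl
      · exact Or.inr ⟨w, hw, by group⟩

end IsAdmissible

end Choices

/-! ### Poincaré series -/

section Poincare

variable {d : ℕ} {Γ : Type*} [Group Γ] [MulAction Γ (Hyp d)] {x₀ : Hyp d} {A B : Set Γ} {s t : ℝ}

theorem poincare_mono (h : A ⊆ B) : poincare x₀ A s ≤ poincare x₀ B s :=
  ENNReal.tsum_mono_subtype (fun g : Γ => ENNReal.ofReal (Real.exp (-s * len x₀ g))) h

theorem poincare_union_le : poincare x₀ (A ∪ B) s ≤ poincare x₀ A s + poincare x₀ B s :=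
  ENNReal.tsum_union_le (fun g : Γ => ENNReal.ofReal (Real.exp (-s * len x₀ g))) A B

theorem poincare_singleton (g : Γ) :
    poincare x₀ {g} s = ENNReal.ofReal (Real.exp (-s * len x₀ g)) :=
  tsum_singleton g (fun g : Γ => ENNReal.ofReal (Real.exp (-s * len x₀ g)))

theorem poincare_anti (h : s ≤ t) : poincare x₀ A t ≤ poincare x₀ A s := by
  refine ENNReal.tsum_le_tsum fun g => ENNReal.ofReal_le_ofReal (Real.exp_le_exp.2 ?_)
  have := mul_le_mul_of_nonneg_right h (len_nonneg x₀ (g : Γ))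
  linarith

theorem poincare_le_of_finset {Y : ENNReal}
    (h : ∀ t : Finset Γ, (t : Set Γ) ⊆ A → poincare x₀ (t : Set Γ) s ≤ Y) :
    poincare x₀ A s ≤ Y := by
  classical
  rw [poincare, ENNReal.tsum_eq_iSup_sum]
  refine iSup_le fun t => ?_
  refine le_trans (le_of_eq ?_) (h (t.map (Function.Embedding.subtype _)) (by
    intro g hg
    simp only [Finset.coe_map, Function.Embedding.subtype_apply, Set.mem_image] at hg
    obtain ⟨x, -, rfl⟩ := hg
    exact x.2))
  rw [poincare, Finset.tsum_subtype' _
    (fun g : Γ => ENNReal.ofReal (Real.exp (-s * len x₀ g))), Finset.sum_map]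
  rfl

theorem poincare_le_of_subset_iUnion {E : ℕ → Set Γ} (hE : Monotone E) {Y : ENNReal}
    (hA : A ⊆ ⋃ n, E n) (h : ∀ n, poincare x₀ (E n) s ≤ Y) : poincare x₀ A s ≤ Y := by
  refine poincare_le_of_finset fun t ht => ?_
  obtain ⟨n, hn⟩ : ∃ n, (t : Set Γ) ⊆ E n :=
    hE.directed_le.exists_mem_subset_of_finset_subset_biUnion (ht.trans hA)
  exact (poincare_mono hn).trans (h n)

/-- `{u a v : u ∈ S, v ∈ T}`. -/
def joinSet {Γ : Type*} [Group Γ] (a : Γ) (S T : Set Γ) : Set Γ :=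
  {w | ∃ u ∈ S, ∃ v ∈ T, w = u * a * v}

/-- `S × T` maps onto the join, so an upper bound needs no unique factorization. -/
theorem poincare_joinSet_le {a : Γ} {S T : Set Γ} {κ : ℝ} (hs : 0 ≤ s)
    (h : ∀ u ∈ S, ∀ v ∈ T, len x₀ u + len x₀ v + κ ≤ len x₀ (u * a * v)) :
    poincare x₀ (joinSet a S T) s ≤
      ENNReal.ofReal (Real.exp (-s * κ)) * (poincare x₀ S s * poincare x₀ T s) := by
  let f : S × T → joinSet a S T := fun p => ⟨p.1 * a * p.2, p.1, p.1.2, p.2, p.2.2, rfl⟩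
  have hf : Function.Surjective f := by
    rintro ⟨w, u, hu, v, hv, rfl⟩
    exact ⟨(⟨u, hu⟩, ⟨v, hv⟩), rfl⟩
  refine (ENNReal.tsum_le_tsum_comp_of_surjective hf _).trans ?_
  unfold poincare
  rw [← ENNReal.tsum_mul_right, ENNReal.tsum_prod', ← ENNReal.tsum_mul_left]
  refine ENNReal.tsum_le_tsum fun u => ?_
  rw [← ENNReal.tsum_mul_left, ← ENNReal.tsum_mul_left]
  refine ENNReal.tsum_le_tsum fun v => ?_
  rw [← ENNReal.ofReal_mul (Real.exp_pos _).le, ← ENNReal.ofReal_mul (Real.exp_pos _).le,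
    ← Real.exp_add, ← Real.exp_add]
  refine ENNReal.ofReal_le_ofReal (Real.exp_le_exp.2 ?_)
  have := mul_le_mul_of_nonneg_left (h u u.2 v v.2) hs
  simp only [f]
  linarith

/-- The words in `W` and the additional letter `φ`, built from `W` by prepending at most `n` times
a block `φ` or `w a φ` with `w ∈ W`. -/
def wordsUpTo {Γ : Type*} [Group Γ] (a φ : Γ) (W : Set Γ) : ℕ → Set Γ
  | 0 => W
  | n + 1 => W ∪ (({φ} ∪ joinSet a W {φ}) ∪
      joinSet a ({φ} ∪ joinSet a W {φ}) (wordsUpTo a φ W n))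

theorem wordsUpTo_monotone (a φ : Γ) (W : Set Γ) : Monotone (wordsUpTo a φ W) := by
  refine monotone_nat_of_le_succ fun n => ?_
  induction n with
  | zero => exact Set.subset_union_left
  | succ n ih =>
    refine Set.union_subset_union_right _ (Set.union_subset_union_right _ ?_)
    rintro w ⟨u, hu, v, hv, rfl⟩
    exact ⟨u, hu, v, ih hv, rfl⟩

theorem wordSet_subset_iUnion_wordsUpTo (a φ : Γ) (A : Set Γ) :
    wordSet a (A ∪ {φ}) ⊆ ⋃ n, wordsUpTo a φ (wordSet a A) n := by
  intro u hu
  rw [Set.mem_iUnion]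
  refine wordSet_induction (p := fun u => ∃ n, u ∈ wordsUpTo a φ (wordSet a A) n) ?_ ?_ u hu
  · rintro g (hg | rfl)
    · exact ⟨0, mem_wordSet_of_mem hg⟩
    · exact ⟨1, Or.inr (Or.inl (Or.inl rfl))⟩
  · rintro g hg v - ⟨n, hv⟩
    rcases hg with hg | rfl
    · refine ⟨n, ?_⟩
      cases n with
      | zero => exact mul_mem_wordSet hg hv
      | succ n =>
        rcases hv with hv | (hv | ⟨w, hw, z, rfl, rfl⟩) |
          ⟨w, hw | ⟨w', hw', z', rfl, rfl⟩, z, hz, rfl⟩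
        · exact Or.inl (mul_mem_wordSet hg hv)
        · obtain rfl : v = φ := hv
          exact Or.inr (Or.inl (Or.inr ⟨g, mem_wordSet_of_mem hg, _, rfl, rfl⟩))
        · exact Or.inr (Or.inl (Or.inr ⟨g * a * w, mul_mem_wordSet hg hw, _, rfl, by group⟩))
        · obtain rfl : w = φ := hw
          exact Or.inr (Or.inr ⟨g * a * w, Or.inr ⟨g, mem_wordSet_of_mem hg, w, rfl, rfl⟩, z, hz,
            by group⟩)
        · exact Or.inr (Or.inr ⟨g * a * (w' * a * z'), Or.inr ⟨g * a * w',
            mul_mem_wordSet hg hw', z', rfl, by group⟩, z, hz, by group⟩)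
    · exact ⟨n + 1, Or.inr (Or.inr ⟨g, Or.inl rfl, v, hv, rfl⟩)⟩

/-- Effect on the Poincaré series of adding one long letter to the alphabet. -/
theorem poincare_wordSet_union_le {a φ : Γ} {Q : Set Γ}
    (hQ : ∀ u ∈ Q, ∀ v ∈ Q, u * a * v ∈ Q ∧ len x₀ u + len x₀ v ≤ len x₀ (u * a * v))
    (hA : A ⊆ Q) (hφ : φ ∈ Q) (hs : 0 ≤ s) {M e : ℝ} (hM : 1 ≤ M)
    (hMA : poincare x₀ (wordSet a A) s ≤ ENNReal.ofReal M) (he : 0 < e) (heM : 2 * e * M < 1)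
    (hφe : Real.exp (-s * len x₀ φ) ≤ e) :
    poincare x₀ (wordSet a (A ∪ {φ})) s ≤
      ENNReal.ofReal ((M + 2 * e + 4 * M * e) / (1 - 2 * e * M)) := by
  -- `Y` solves `Y = M + 2e + 4Me + 2eMY`. As `M ≥ 1`, this dominates the recursion `Y ↦ M + (e +
  -- Me)(1 + Y)` for one more block containing `φ`, so the bound by `Y` persists for all `n`.
  set Y := (M + 2 * e + 4 * M * e) / (1 - 2 * e * M) with hY
  have hden : 0 < 1 - 2 * e * M := by linarith
  have hY0 : 0 < Y := by positivity
  have hYeq : Y = M + 2 * e + 4 * M * e + 2 * e * M * Y := by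
    have : Y * (1 - 2 * e * M) = M + 2 * e + 4 * M * e := div_mul_cancel₀ _ hden.ne'
    linarith
  have hMe : 0 < M * e := by positivity
  have hWQ : wordSet a A ⊆ Q :=
    wordSet_induction hA fun g hg v _ hv => (hQ g (hA hg) v hv).1
  have hjoin : ∀ S T : Set Γ, S ⊆ Q → T ⊆ Q →
      poincare x₀ (joinSet a S T) s ≤ poincare x₀ S s * poincare x₀ T s := fun S T hS hT => by
    have := poincare_joinSet_le (a := a) (x₀ := x₀) (κ := 0) hs
      (fun u hu v hv => by simpa using (hQ u (hS hu) v (hT hv)).2)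
    simpa using this
  have hφQ : ({φ} : Set Γ) ⊆ Q := Set.singleton_subset_iff.2 hφ
  have hjQ : ∀ S T : Set Γ, S ⊆ Q → T ⊆ Q → joinSet a S T ⊆ Q := by
    rintro S T hS hT w ⟨u, hu, v, hv, rfl⟩
    exact (hQ u (hS hu) v (hT hv)).1
  have hVQ : {φ} ∪ joinSet a (wordSet a A) {φ} ⊆ Q := Set.union_subset hφQ (hjQ _ _ hWQ hφQ)
  have hφle : poincare x₀ {φ} s ≤ ENNReal.ofReal e := by
    rw [poincare_singleton]
    exact ENNReal.ofReal_le_ofReal hφe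
  have hV : poincare x₀ ({φ} ∪ joinSet a (wordSet a A) {φ}) s ≤ ENNReal.ofReal (e + M * e) := by
    rw [ENNReal.ofReal_add he.le hMe.le, ENNReal.ofReal_mul (by linarith)]
    exact poincare_union_le.trans (add_le_add hφle
      ((hjoin _ _ hWQ hφQ).trans (mul_le_mul' hMA hφle)))
  have hEQ : ∀ n, wordsUpTo a φ (wordSet a A) n ⊆ Q := fun n => by
    induction n with
    | zero => exact hWQ
    | succ n ih => exact Set.union_subset hWQ (Set.union_subset hVQ (hjQ _ _ hVQ ih))
  refine poincare_le_of_subset_iUnion (wordsUpTo_monotone a φ (wordSet a A))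
    (wordSet_subset_iUnion_wordsUpTo a φ A) fun n => ?_
  induction n with
  | zero =>
    refine hMA.trans (ENNReal.ofReal_le_ofReal ?_)
    have : 0 < e * M * Y := by positivity
    linarith
  | succ n ih =>
    calc poincare x₀ (wordsUpTo a φ (wordSet a A) (n + 1)) s
        ≤ ENNReal.ofReal M + (ENNReal.ofReal (e + M * e) +
            ENNReal.ofReal (e + M * e) * ENNReal.ofReal Y) :=
          poincare_union_le.trans (add_le_add hMA (poincare_union_le.trans (add_le_add hV
            ((hjoin _ _ hVQ (hEQ n)).trans (mul_le_mul' hV ih)))))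
      _ = ENNReal.ofReal (M + ((e + M * e) + (e + M * e) * Y)) := by
          rw [← ENNReal.ofReal_mul (by positivity), ← ENNReal.ofReal_add (by positivity)
            (by positivity), ← ENNReal.ofReal_add (by positivity) (by positivity)]
      _ ≤ ENNReal.ofReal Y := by
          refine ENNReal.ofReal_le_ofReal ?_
          have : e ≤ M * e := by nlinarith
          nlinarith

/-- The words in a finite alphabet have a finite critical exponent. -/
theorem exists_poincare_wordSet_lt_top {a : Γ} {Q : Set Γ} {ρ : ℝ} (hρ : 0 < ρ)
    (hQ : ∀ u ∈ Q, ∀ v ∈ Q, u * a * v ∈ Q ∧ len x₀ u + len x₀ v ≤ len x₀ (u * a * v))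
    (hA : A ⊆ Q) (hfin : A.Finite) (hlen : ∀ g ∈ A, ρ ≤ len x₀ g) :
    ∃ s : ℝ, 0 ≤ s ∧ poincare x₀ (wordSet a A) s < ⊤ := by
  -- Once `P_A(s) ≤ 1/2`, the bound `1` for words up to a given length persists: `1/2 + 1/2 · 1 =
  -- 1`.
  obtain ⟨s, hs, hsA⟩ : ∃ s : ℝ, 0 ≤ s ∧ poincare x₀ A s ≤ 1 / 2 := by
    set N : ℝ := (hfin.toFinset.card : ℝ)
    refine ⟨2 * N / ρ, by positivity, ?_⟩
    have hN : N * Real.exp (-(2 * N)) ≤ 1 / 2 := by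
      have h1 := Real.add_one_le_exp (2 * N)
      rw [Real.exp_neg, ← div_eq_mul_inv, div_le_iff₀ (Real.exp_pos _)]
      linarith
    have e : poincare x₀ A (2 * N / ρ) =
        ∑ g ∈ hfin.toFinset, ENNReal.ofReal (Real.exp (-(2 * N / ρ) * len x₀ g)) := by
      rw [← Finset.tsum_subtype' _
        (fun g : Γ => ENNReal.ofReal (Real.exp (-(2 * N / ρ) * len x₀ g))), hfin.coe_toFinset,
        poincare]
    rw [e, ← ENNReal.ofReal_sum_of_nonneg fun _ _ => (Real.exp_pos _).le,
      show (1 / 2 : ENNReal) = ENNReal.ofReal (1 / 2) by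
        rw [ENNReal.ofReal_div_of_pos two_pos]; simp]
    refine ENNReal.ofReal_le_ofReal (le_trans (Finset.sum_le_card_nsmul _ _
      (Real.exp (-(2 * N))) fun g hg => Real.exp_le_exp.2 ?_) (by simpa using hN))
    have h1 := hlen g (hfin.mem_toFinset.1 hg)
    have h2 : 2 * N / ρ * ρ ≤ 2 * N / ρ * len x₀ g :=
      mul_le_mul_of_nonneg_left h1 (by positivity)
    rw [div_mul_cancel₀ _ hρ.ne'] at h2
    linarith
  let E : ℕ → Set Γ := fun n => Nat.rec A (fun _ S => A ∪ joinSet a A S) n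
  have hE : ∀ n, E (n + 1) = A ∪ joinSet a A (E n) := fun _ => rfl
  have hmono : Monotone E := by
    refine monotone_nat_of_le_succ fun n => ?_
    induction n with
    | zero => exact Set.subset_union_left
    | succ n ih =>
      rw [hE n, hE (n + 1)]
      refine Set.union_subset_union_right _ ?_
      rintro w ⟨u, hu, v, hv, rfl⟩
      exact ⟨u, hu, v, ih hv, rfl⟩
  have hEQ : ∀ n, E n ⊆ Q := fun n => by
    induction n with
    | zero => exact hA
    | succ n ih =>
      refine Set.union_subset hA ?_
      rintro w ⟨u, hu, v, hv, rfl⟩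
      exact (hQ u (hA hu) v (ih hv)).1
  refine ⟨s, hs, lt_of_le_of_lt (poincare_le_of_subset_iUnion hmono (Y := 1) ?_ fun n => ?_)
    ENNReal.one_lt_top⟩
  · intro u hu
    rw [Set.mem_iUnion]
    refine wordSet_induction (p := fun u => ∃ n, u ∈ E n) (fun g hg => ⟨0, hg⟩) ?_ u hu
    rintro g hg v - ⟨n, hv⟩
    exact ⟨n + 1, Or.inr ⟨g, hg, v, hv, rfl⟩⟩
  · induction n with
    | zero => exact hsA.trans (by norm_num)
    | succ n ih =>
      have hj := poincare_joinSet_le (a := a) (x₀ := x₀) (S := A) (T := E n) (κ := 0) hs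
        (fun u hu v hv => by simpa using (hQ u (hA hu) v (hEQ n hv)).2)
      rw [mul_zero, Real.exp_zero, ENNReal.ofReal_one, one_mul] at hj
      calc poincare x₀ (E (n + 1)) s ≤ 1 / 2 + 1 / 2 * 1 :=
            poincare_union_le.trans (add_le_add hsA (hj.trans (mul_le_mul' hsA ih)))
        _ = 1 := by rw [mul_one, ENNReal.add_halves]

end Poincare

/-! ### Finiteness of orbit balls -/

section Discrete

variable {d : ℕ}

/-- Hyperbolic balls are compact. -/
theorem isCompact_hdist_le (x₀ : Hyp d) (r : ℝ) : IsCompact {x : Hyp d | hdist x x₀ ≤ r} := by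
  -- The inequality `e^{d/2} ≤ e^{r/2}` with denominators cleared is a closed condition on the
  -- closed ball. It fails on the sphere, where the right side vanishes and `expNum` is positive.
  set T : Set (HypBar d) := {ζ | expNum ζ x₀ ≤ Real.exp (r / 2) *
    (Real.sqrt (1 - ‖ζ.1‖ ^ 2) * Real.sqrt (1 - ‖x₀.1‖ ^ 2))} with hT
  have hTc : IsCompact T := by
    have : CompactSpace (HypBar d) := isCompact_iff_compactSpace.1 (isCompact_closedBall _ _)
    exact (isClosed_le (continuous_expNum x₀) (by fun_prop)).isCompact
  have hrange : T ⊆ Set.range toBar := by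
    intro ζ hζ
    have hle : ‖ζ.1‖ ≤ 1 := mem_closedBall_zero_iff.1 ζ.2
    rcases hle.lt_or_eq with h | h
    · exact ⟨⟨ζ.1, mem_ball_zero_iff.2 h⟩, rfl⟩
    · have := expNum_pos ζ x₀
      simp only [hT, Set.mem_ofPred_eq, h] at hζ
      norm_num at hζ
      linarith
  have hind : IsInducing (toBar : Hyp d → HypBar d) :=
    IsInducing.of_comp (by unfold toBar; fun_prop) continuous_subtype_val IsInducing.subtypeVal
  have hpre : {x : Hyp d | hdist x x₀ ≤ r} = toBar ⁻¹' T := by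
    ext x
    have hx := Real.sqrt_pos.2 (one_sub_sq_pos x)
    have hx₀ := Real.sqrt_pos.2 (one_sub_sq_pos x₀)
    have h := hdist_eq_log x x₀
    have hlog : Real.log (Real.exp (r / 2) * (Real.sqrt (1 - ‖x.1‖ ^ 2) *
        Real.sqrt (1 - ‖x₀.1‖ ^ 2))) = r / 2 + (Real.log (Real.sqrt (1 - ‖x.1‖ ^ 2)) +
          Real.log (Real.sqrt (1 - ‖x₀.1‖ ^ 2))) := by
      rw [Real.log_mul (Real.exp_pos _).ne' (by positivity), Real.log_exp,
        Real.log_mul hx.ne' hx₀.ne']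
    have hiff : toBar x ∈ T ↔ Real.log (expNum (toBar x) x₀) ≤ Real.log (Real.exp (r / 2) *
        (Real.sqrt (1 - ‖x.1‖ ^ 2) * Real.sqrt (1 - ‖x₀.1‖ ^ 2))) :=
      (Real.log_le_log_iff (expNum_pos _ _) (by positivity)).symm
    rw [Set.mem_preimage, hiff, hlog, Set.mem_ofPred_eq, h]
    constructor <;> intro h' <;> linarith
  rw [hpre]
  exact (hind.isCompact_preimage_iff hrange).2 hTc

theorem finite_ballOf {Γ : Type*} [Group Γ] [MulAction Γ (Hyp d)]
    [ProperlyDiscontinuousSMul Γ (Hyp d)] (x₀ : Hyp d) (r : ℝ) : (ballOf Γ x₀ r).Finite := by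
  refine (ProperlyDiscontinuousSMul.finite_disjoint_inter_image (Γ := Γ)
    (isCompact_singleton (x := x₀)) (isCompact_hdist_le x₀ r)).subset fun g hg => ?_
  have hg' : hdist x₀ (g • x₀) < r := hg
  rw [hdist_comm] at hg'
  exact (⟨g • x₀, ⟨x₀, rfl, rfl⟩, hg'.le⟩ :
    (((g • ·) '' {x₀}) ∩ {x : Hyp d | hdist x x₀ ≤ r}).Nonempty)

end Discrete

/-! ### The critical exponent of `F` and divergence of its series there -/

namespace Choices

section

variable {Γ : Type*} [Group Γ] (D : Choices Γ)

theorem alphabet_mono : Monotone D.alphabet := fun i j hij => by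
  refine Set.union_subset_union_right _ ?_
  rintro g ⟨k, hk, hki, rfl⟩
  exact ⟨k, hk, by omega, rfl⟩

theorem stage_mono : Monotone D.stage := fun _ _ hij => wordSet_mono (D.alphabet_mono hij)

theorem alphabet_subset (i : ℕ) : D.alphabet i ⊆ D.letters := by
  refine Set.union_subset_union_right _ ?_
  rintro g ⟨k, hk, -, rfl⟩
  exact ⟨k, hk, rfl⟩

theorem stage_subset (i : ℕ) : D.stage i ⊆ D.F := wordSet_mono (D.alphabet_subset i)

theorem alphabet_succ_subset (k : ℕ) : D.alphabet (k + 1) ⊆ D.alphabet k ∪ {D.letter k} := by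
  rintro g (hg | ⟨j, hj, hjk, rfl⟩)
  · exact Or.inl (Or.inl hg)
  · rcases (Nat.lt_succ_iff.1 hjk).eq_or_lt with rfl | h
    · exact Or.inr rfl
    · exact Or.inl (Or.inr ⟨j, hj, h, rfl⟩)

theorem F_subset_iUnion (j : ℕ) : D.F ⊆ ⋃ m, D.stage (j + m) := by
  intro u hu
  rw [Set.mem_iUnion]
  refine wordSet_induction (p := fun u => ∃ m, u ∈ D.stage (j + m)) ?_ ?_ u hu
  · rintro g (hg | ⟨k, hk, rfl⟩)
    · exact ⟨0, mem_wordSet_of_mem (Or.inl hg)⟩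
    · exact ⟨k + 1, mem_wordSet_of_mem (Or.inr ⟨k, hk, by omega, rfl⟩)⟩
  · rintro g hg v - ⟨m, hv⟩
    rcases hg with hg | ⟨k, hk, rfl⟩
    · exact ⟨m, mul_mem_wordSet (Or.inl hg) hv⟩
    · exact ⟨m + k + 1, mul_mem_wordSet (Or.inr ⟨k, hk, by omega, rfl⟩)
        (D.stage_mono (by omega) hv)⟩

end

namespace IsAdmissible

variable {d : ℕ} {Γ : Type*} [Group Γ] [MulAction Γ (Hyp d)] {D : Choices Γ} {x₀ : Hyp d}

theorem β_pos (hD : D.IsAdmissible x₀) {j : ℕ} (hj : 1 ≤ j) : 0 < D.β j :=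
  (critExp_nonneg _ _).trans_lt (hD.β_gt j hj)

variable (hiso : ∀ (g : Γ) (x y : Hyp d), hdist (g • x) (g • y) = hdist x y)

include hiso

theorem propertyA_join (hD : D.IsAdmissible x₀) :
    ∀ u ∈ {u | PropertyA x₀ D.a u}, ∀ v ∈ {v | PropertyA x₀ D.a v},
      u * D.a * v ∈ {u | PropertyA x₀ D.a u} ∧
        len x₀ u + len x₀ v ≤ len x₀ (u * D.a * v) := fun u hu v hv => by
  refine ⟨PropertyA.mul hiso hu hv, ?_⟩
  have := PropertyA.len_mul_ge hiso hD.lt_len_a hu hv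
  linarith [hD.lt_len_a]

theorem poincare_stage_ne_top [ProperlyDiscontinuousSMul Γ (Hyp d)] (hD : D.IsAdmissible x₀)
    {j : ℕ} (hj : 1 ≤ j) : poincare x₀ (D.stage j) (D.β j) ≠ ⊤ := by
  -- The real infimum of the empty set is `0`, so `β_gt` gives convergence at `β_j` only once this
  -- set is known to be nonempty.
  have hne : {s : ℝ | 0 ≤ s ∧ poincare x₀ (D.stage j) s < ⊤}.Nonempty :=
    exists_poincare_wordSet_lt_top (Q := {u | PropertyA x₀ D.a u}) (ρ := len x₀ D.a)
      (by linarith [hD.lt_len_a]) (hD.propertyA_join hiso)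
      (fun g hg => hD.letters_propertyA hiso (D.alphabet_subset j hg))
      ((finite_ballOf x₀ _).subset (hD.R_ball j hj))
      fun g hg => (hD.letters_propertyA hiso (D.alphabet_subset j hg)).le_len hD.lt_len_a
  obtain ⟨s, hs, hlt⟩ := exists_lt_of_csInf_lt hne (hD.β_gt j hj)
  exact ((poincare_anti hlt.le).trans_lt hs.2).ne

/-- Each added letter `φ_k` has length at least `R_k`, so `R_exp` bounds the growth of the series at
`β_j`; the factors `2 - 2^{-m}` keep all later stages below twice the first. -/
theorem poincare_stage_le [ProperlyDiscontinuousSMul Γ (Hyp d)] (hD : D.IsAdmissible x₀) {j : ℕ} (hj : 1 ≤ j) (m : ℕ) :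
    poincare x₀ (D.stage (j + m)) (D.β j) ≤
      ENNReal.ofReal ((2 - (1 / 2) ^ m) * (poincare x₀ (D.stage j) (D.β j)).toReal) := by
  induction m with
  | zero =>
    have := hD.poincare_stage_ne_top hiso hj
    rw [pow_zero, show (2 : ℝ) - 1 = 1 by norm_num, one_mul, ENNReal.ofReal_toReal this,
      Nat.add_zero]
  | succ m ih =>
    obtain ⟨e, he, -, heM, hlt, hexp⟩ := hD.R_exp (j + m) j hj (by omega)
    set M := (poincare x₀ (D.stage (j + m)) (D.β j)).toReal
    have htop : poincare x₀ (D.stage (j + m)) (D.β j) ≠ ⊤ :=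
      (ih.trans_lt ENNReal.ofReal_lt_top).ne
    have hM : 1 ≤ M := by
      have h1 : (1 : ENNReal) ≤ poincare x₀ (D.stage (j + m)) (D.β j) :=
        calc (1 : ENNReal) ≤ 2 ^ j := one_le_pow₀ one_le_two
          _ ≤ poincare x₀ (D.stage j) (D.β j) := (hD.β_large j hj).le
          _ ≤ _ := poincare_mono (D.stage_mono (by omega))
      simpa using ENNReal.toReal_mono htop h1
    have hφ : Real.exp (-D.β j * len x₀ (D.letter (j + m))) ≤ e := by
      refine le_trans (Real.exp_le_exp.2 ?_) hexp
      have := mul_le_mul_of_nonneg_left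
        (hD.R_le_len_letter hiso (k := j + m) (by omega)) (hD.β_pos hj).le
      linarith
    have key := poincare_wordSet_union_le (hD.propertyA_join hiso)
      (fun g hg => hD.letters_propertyA hiso (D.alphabet_subset (j + m) hg))
      (hD.letter_propertyA hiso (j + m)) (hD.β_pos hj).le hM
      (ENNReal.ofReal_toReal htop).ge he heM hφ
    refine (poincare_mono (wordSet_mono (D.alphabet_succ_subset (j + m)))).trans
      (key.trans (ENNReal.ofReal_le_ofReal ?_))
    rw [show j + m + 1 - j = m + 1 by omega] at hlt
    exact hlt.le

/-- The uniform bound on the stages makes `P_F(β_i)` finite for all `i`; strictness comes from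
`β_{j+1} < β_j`. -/
theorem critExp_F_lt [ProperlyDiscontinuousSMul Γ (Hyp d)] (hD : D.IsAdmissible x₀) {j : ℕ} (hj : 1 ≤ j) :
    critExp x₀ D.F < D.β j := by
  have hle : ∀ i, 1 ≤ i → critExp x₀ D.F ≤ D.β i := fun i hi => by
    refine csInf_le ⟨0, fun s hs => hs.1⟩ ⟨(hD.β_pos hi).le, ?_⟩
    refine lt_of_le_of_lt (poincare_le_of_subset_iUnion
      (fun m n hmn => D.stage_mono (Nat.add_le_add_left hmn i)) (D.F_subset_iUnion i)
      (Y := ENNReal.ofReal (2 * (poincare x₀ (D.stage i) (D.β i)).toReal)) fun m => ?_)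
      ENNReal.ofReal_lt_top
    refine (hD.poincare_stage_le hiso hi m).trans (ENNReal.ofReal_le_ofReal ?_)
    refine mul_le_mul_of_nonneg_right ?_ ENNReal.toReal_nonneg
    have : (0 : ℝ) < (1 / 2) ^ m := by positivity
    linarith
  exact (hle (j + 1) (by omega)).trans_lt (hD.β_anti j hj)

omit hiso in
-- With `critExp_F_lt` this is divergence at the critical exponent.
theorem lt_poincare_F (hD : D.IsAdmissible x₀) {k : ℕ} (hk : 1 ≤ k) {s : ℝ} (hs : s ≤ D.β k) :
    2 ^ k < poincare x₀ D.F s :=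
  (hD.β_large k hk).trans_le ((poincare_anti hs).trans (poincare_mono (D.stage_subset k)))

end IsAdmissible

end Choices

/-! ### The approximating measures -/

section OrbitMeasure

variable {d : ℕ} {Γ : Type*} [Group Γ] [MulAction Γ (Hyp d)] {x₀ : Hyp d} {A : Set Γ} {s : ℝ}

theorem orbitMeasure_apply {S : Set (HypBar d)} (hS : MeasurableSet S) :
    orbitMeasure x₀ A s S =
      (poincare x₀ A s)⁻¹ * poincare x₀ {g | g ∈ A ∧ toBar (g • x₀) ∈ S} s := by
  rw [orbitMeasure, Measure.smul_apply, Measure.sum_apply _ hS, smul_eq_mul]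
  congr 1
  rw [poincare, tsum_subtype {g | g ∈ A ∧ toBar (g • x₀) ∈ S}
    (fun g => ENNReal.ofReal (Real.exp (-s * len x₀ g))),
    tsum_subtype A fun g : Γ => (ENNReal.ofReal (Real.exp (-s * len x₀ g)) •
    Measure.dirac (toBar (g • x₀))) S]
  refine tsum_congr fun g => ?_
  by_cases h1 : g ∈ A <;> by_cases h2 : toBar (g • x₀) ∈ S <;>
    simp [Set.indicator, h1, h2, hS]

/-- Because `⊤⁻¹ = 0`, a divergent series would make the measure zero. -/
theorem poincare_ne_top_of_isProbabilityMeasure (h : IsProbabilityMeasure (orbitMeasure x₀ A s)) :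
    poincare x₀ A s ≠ ⊤ := by
  intro htop
  have h1 := h.measure_univ
  rw [orbitMeasure, htop, ENNReal.inv_top, zero_smul] at h1
  simp at h1

end OrbitMeasure

/-! ### Measures of shadows and the weak limit -/

namespace Choices.IsAdmissible

variable {d : ℕ} {Γ : Type*} [Group Γ] [MulAction Γ (Hyp d)] {D : Choices Γ} {x₀ : Hyp d}
  (hiso : ∀ (g : Γ) (x y : Hyp d), hdist (g • x) (g • y) = hdist x y)

include hiso

/-- The elements `g a h`, `h ∈ F`, lie in the shadow of `g`. -/
theorem le_orbitMeasure_shadow (hD : D.IsAdmissible x₀) {s : ℝ} (hs : 0 ≤ s)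
    (hprob : IsProbabilityMeasure (orbitMeasure x₀ D.F s)) {g : Γ} (hg : g ∈ D.F) :
    ENNReal.ofReal (Real.exp (-s * (len x₀ g + len x₀ D.a))) ≤
      orbitMeasure x₀ D.F s (shadow x₀ (g • x₀) (8 * D.C x₀)) := by
  have hC := hD.C_pos
  have ha : len x₀ D.a = 1000 * D.C x₀ := by unfold Choices.C; ring
  rw [orbitMeasure_apply (isClosed_shadow _ _ _).measurableSet]
  have htop := poincare_ne_top_of_isProbabilityMeasure hprob
  have hpos : poincare x₀ D.F s ≠ 0 := by
    refine (lt_of_lt_of_le ?_ (poincare_mono (Set.singleton_subset_iff.2 hg))).ne'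
    rw [poincare_singleton]
    exact ENNReal.ofReal_pos.2 (Real.exp_pos _)
  have key : ENNReal.ofReal (Real.exp (-s * (len x₀ g + len x₀ D.a))) * poincare x₀ D.F s ≤
      poincare x₀ {h | h ∈ D.F ∧ toBar (h • x₀) ∈ shadow x₀ (g • x₀) (8 * D.C x₀)} s := by
    let f : D.F → {h | h ∈ D.F ∧ toBar (h • x₀) ∈ shadow x₀ (g • x₀) (8 * D.C x₀)} :=
      fun h => ⟨g * D.a * h, wordSet_mul_mem hg h.2, by
        rw [toBar_mem_shadow_iff, gromov_comm]
        have := (hD.F_propertyA hiso g hg).gromov_le hiso hD.lt_len_a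
          (hD.F_propertyA hiso h h.2)
        linarith⟩
    have hf : Function.Injective f := fun h h' hh => by
      have := congrArg Subtype.val hh
      exact Subtype.ext (mul_left_cancel this)
    refine le_trans ?_ (ENNReal.tsum_comp_le_tsum_of_injective hf _)
    unfold poincare
    rw [← ENNReal.tsum_mul_left]
    refine ENNReal.tsum_le_tsum fun h => ?_
    rw [← ENNReal.ofReal_mul (Real.exp_pos _).le, ← Real.exp_add]
    refine ENNReal.ofReal_le_ofReal (Real.exp_le_exp.2 ?_)
    have h1 := len_mul_le hiso (x₀ := x₀) (g * D.a) h
    have h2 := len_mul_le hiso (x₀ := x₀) g D.a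
    have := mul_le_mul_of_nonneg_left (h1.trans (add_le_add_left h2 _)) hs
    simp only [f]
    linarith
  calc ENNReal.ofReal (Real.exp (-s * (len x₀ g + len x₀ D.a)))
      = (poincare x₀ D.F s)⁻¹ *
        (ENNReal.ofReal (Real.exp (-s * (len x₀ g + len x₀ D.a))) * poincare x₀ D.F s) := by
        rw [mul_left_comm, ENNReal.inv_mul_cancel hpos htop, mul_one]
    _ ≤ _ := mul_le_mul_right key _

/-- The elements of `F` in a slightly larger shadow of `g` are `g` and the `g a h`, `h ∈ F`. -/
theorem orbitMeasure_le (hD : D.IsAdmissible x₀) {s : ℝ} (hs : 0 ≤ s)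
    (hprob : IsProbabilityMeasure (orbitMeasure x₀ D.F s)) {g : Γ} (hg : g ∈ D.F)
    {U : Set (HypBar d)} (hU : IsOpen U)
    (hUg : ∀ w : Hyp d, toBar w ∈ U → gromov w x₀ (g • x₀) ≤ 8.5 * D.C x₀) :
    orbitMeasure x₀ D.F s U ≤ ENNReal.ofReal (Real.exp (-s * len x₀ g)) *
      ((poincare x₀ D.F s)⁻¹ + ENNReal.ofReal (Real.exp (-s))) := by
  rw [orbitMeasure_apply hU.measurableSet]
  have htop := poincare_ne_top_of_isProbabilityMeasure hprob
  have hpos : poincare x₀ D.F s ≠ 0 := by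
    refine (lt_of_lt_of_le ?_ (poincare_mono (Set.singleton_subset_iff.2 hg))).ne'
    rw [poincare_singleton]
    exact ENNReal.ofReal_pos.2 (Real.exp_pos _)
  have hsub : {h | h ∈ D.F ∧ toBar (h • x₀) ∈ U} ⊆ {g} ∪ joinSet D.a {g} D.F := by
    rintro h ⟨hh, hhU⟩
    have := hD.prefix_of_gromov_le hiso g hg 1 (Or.inl rfl) h hh
      (by simpa only [one_mul] using hUg _ hhU)
    rcases this with rfl | ⟨v, hv, rfl⟩
    · exact Or.inl rfl
    · exact Or.inr ⟨g, rfl, v, hv, rfl⟩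
  -- The true gain is `0.9 ‖a‖`. Any positive `κ` would do: the factor `e^{-sκ} < 1` leaves room for
  -- `P_F(s)⁻¹`.
  have hjoin := poincare_joinSet_le (a := D.a) (x₀ := x₀) (S := {g}) (T := D.F) (κ := 1) hs
    (fun u hu v hv => by
      obtain rfl : u = g := hu
      have := (hD.F_propertyA hiso u hg).len_mul_ge hiso hD.lt_len_a (hD.F_propertyA hiso v hv)
      linarith [hD.lt_len_a])
  rw [poincare_singleton, mul_one] at hjoin
  have hle := (poincare_mono (x₀ := x₀) (s := s) hsub).trans
    (poincare_union_le.trans (add_le_add (poincare_singleton g).le hjoin))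
  refine (mul_le_mul_right hle _).trans (le_of_eq ?_)
  set P := poincare x₀ D.F s
  set E := ENNReal.ofReal (Real.exp (-s * len x₀ g))
  set e := ENNReal.ofReal (Real.exp (-s))
  calc P⁻¹ * (E + e * (E * P)) = E * (P⁻¹ + e * (P⁻¹ * P)) := by ring
    _ = E * (P⁻¹ + e) := by rw [ENNReal.inv_mul_cancel hpos htop, mul_one]

theorem le_measure_shadow (hD : D.IsAdmissible x₀) {μ : ProbabilityMeasure (HypBar d)}
    (hμ : IsPattersonSullivan x₀ D.F μ) {g : Γ} (hg : g ∈ D.F) :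
    ENNReal.ofReal (Real.exp (-critExp x₀ D.F * (len x₀ g + len x₀ D.a))) ≤
      (μ : Measure (HypBar d)) (shadow x₀ (g • x₀) (8 * D.C x₀)) := by
  obtain ⟨s, ν, hs, hlim, hν, hνμ⟩ := hμ
  have hclosed := ProbabilityMeasure.limsup_measure_closed_le_of_tendsto hνμ
    (isClosed_shadow x₀ (g • x₀) (8 * D.C x₀))
  refine le_trans ?_ hclosed
  have ht : Tendsto (fun n => ENNReal.ofReal (Real.exp (-s n * (len x₀ g + len x₀ D.a)))) atTop
      (𝓝 (ENNReal.ofReal (Real.exp (-critExp x₀ D.F * (len x₀ g + len x₀ D.a))))) :=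
    ENNReal.tendsto_ofReal ((Real.continuous_exp.tendsto _).comp (hlim.neg.mul_const _))
  rw [← ht.limsup_eq]
  refine limsup_le_limsup (Eventually.of_forall fun n => ?_)
  have hp : IsProbabilityMeasure (orbitMeasure x₀ D.F (s n)) := hν n ▸ inferInstance
  simp only [hν n]
  exact hD.le_orbitMeasure_shadow hiso ((critExp_nonneg _ _).trans (hs n).le) hp hg

theorem measure_shadow_le [ProperlyDiscontinuousSMul Γ (Hyp d)] (hD : D.IsAdmissible x₀)
    {μ : ProbabilityMeasure (HypBar d)}
    (hμ : IsPattersonSullivan x₀ D.F μ) {g : Γ} (hg : g ∈ D.F) :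
    (μ : Measure (HypBar d)) (shadow x₀ (g • x₀) (8 * D.C x₀)) ≤
      ENNReal.ofReal (Real.exp (-critExp x₀ D.F * len x₀ g)) := by
  -- For `δ_F = 0` the factor `e^{-s}` gives no gain in the limit, but the claimed bound is `1`.
  rcases (critExp_nonneg x₀ D.F).eq_or_lt with h0 | hδ
  · rw [← h0, neg_zero, zero_mul, Real.exp_zero, ENNReal.ofReal_one]
    exact prob_le_one
  obtain ⟨s, ν, hs, hlim, hν, hνμ⟩ := hμ
  have hC := hD.C_pos
  obtain ⟨U, hU, hSU, hUg⟩ := exists_open_between_shadows x₀ (g • x₀)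
    (by linarith : 8 * D.C x₀ < 8.5 * D.C x₀)
  set δ := critExp x₀ D.F
  refine (measure_mono hSU).trans
    ((ProbabilityMeasure.le_liminf_measure_open_of_tendsto hνμ hU).trans ?_)
  have hexp : 0 < 1 - Real.exp (-δ) := by
    have := Real.exp_lt_exp.2 (neg_lt_zero.2 hδ)
    rw [Real.exp_zero] at this
    linarith
  -- For `s_n < β_{k+1}` one has `P_F(s_n)⁻¹ ≤ 2^{-(k+1)}`, which fits into the gap `1 - e^{-δ_F}`.
  obtain ⟨k, hk⟩ := exists_pow_lt_of_lt_one hexp (by norm_num : (1 / 2 : ℝ) < 1)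
  have hk1 : (1 / 2 : ℝ) ^ (k + 1) ≤ 1 - Real.exp (-δ) := by
    rw [pow_succ]
    have : (0 : ℝ) < (1 / 2) ^ k := by positivity
    linarith
  have hev : ∀ᶠ n in atTop, s n < D.β (k + 1) :=
    hlim.eventually_lt_const (hD.critExp_F_lt hiso (by omega))
  refine liminf_le_of_frequently_le' (hev.mono fun n hn => ?_).frequently
  have hp : IsProbabilityMeasure (orbitMeasure x₀ D.F (s n)) := hν n ▸ inferInstance
  have hs0 : 0 ≤ s n := hδ.le.trans (hs n).le
  rw [hν n]
  refine (hD.orbitMeasure_le hiso hs0 hp hg hU hUg).trans ?_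
  have h1 : (poincare x₀ D.F (s n))⁻¹ ≤ ENNReal.ofReal ((1 / 2) ^ (k + 1)) := by
    refine (ENNReal.inv_le_inv.2 (hD.lt_poincare_F (k := k + 1) (by omega) hn.le).le).trans
      (le_of_eq ?_)
    rw [ENNReal.ofReal_pow (by norm_num), one_div, ENNReal.ofReal_inv_of_pos two_pos,
      ENNReal.ofReal_ofNat, ENNReal.inv_pow]
  have h2 : Real.exp (-s n) ≤ Real.exp (-δ) := Real.exp_le_exp.2 (by linarith [hs n])
  have h3 : (poincare x₀ D.F (s n))⁻¹ + ENNReal.ofReal (Real.exp (-s n)) ≤ 1 := by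
    refine (add_le_add_left h1 _).trans ?_
    rw [← ENNReal.ofReal_add (by positivity) (Real.exp_pos _).le]
    exact ENNReal.ofReal_le_one.2 (by linarith)
  refine (mul_le_mul' (ENNReal.ofReal_le_ofReal (Real.exp_le_exp.2 ?_)) h3).trans
    (mul_one _).le
  have := mul_le_mul_of_nonneg_right (hs n).le (len_nonneg x₀ g)
  linarith

end Choices.IsAdmissible

end Shadow

theorem mainTheorem4 {d : ℕ} {Γ : Type*} [Group Γ] [MulAction Γ (Shadow.Hyp d)]
    [ProperlyDiscontinuousSMul Γ (Shadow.Hyp d)]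
    (hiso : ∀ (g : Γ) (x y : Shadow.Hyp d),
      Shadow.hdist (g • x) (g • y) = Shadow.hdist x y)
    (x₀ : Shadow.Hyp d)
    (hne : Shadow.IsNonElementary Γ x₀) (hncc : ¬ Shadow.IsConvexCocompact Γ x₀)
    (D : Shadow.Choices Γ) (hD : D.IsAdmissible x₀)
    (μ : MeasureTheory.ProbabilityMeasure (Shadow.HypBar d))
    (hμ : Shadow.IsPattersonSullivan x₀ D.F μ)
    (K : ℝ) (hK : K = Real.exp (Shadow.critExp x₀ D.F * 10 ^ 7 * D.C x₀))
    (g : Γ) (hg : g ∈ D.F) :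
    1 / K * Real.exp (-Shadow.critExp x₀ D.F * Shadow.len x₀ g)
        ≤ (μ : MeasureTheory.Measure (Shadow.HypBar d)).real
            (Shadow.shadow x₀ (g • x₀) (8 * D.C x₀)) ∧
      (μ : MeasureTheory.Measure (Shadow.HypBar d)).real
          (Shadow.shadow x₀ (g • x₀) (8 * D.C x₀))
        ≤ Real.exp (-Shadow.critExp x₀ D.F * Shadow.len x₀ g) := by
  have hlow := hD.le_measure_shadow hiso hμ hg
  have hup := hD.measure_shadow_le hiso hμ hg
  constructor
  · have h1 := (ENNReal.ofReal_le_iff_le_toReal (measure_ne_top _ _)).1 hlow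
    refine le_trans ?_ h1
    rw [hK, one_div, ← Real.exp_neg, ← Real.exp_add, Real.exp_le_exp]
    have hδ := Shadow.critExp_nonneg x₀ D.F
    have hC := hD.C_pos
    have ha : Shadow.len x₀ D.a = 1000 * D.C x₀ := by unfold Shadow.Choices.C; ring
    have : 0 ≤ Shadow.critExp x₀ D.F * D.C x₀ := mul_nonneg hδ (by linarith)
    -- The lower bound holds with the loss `e^{δ_F ‖a‖} = e^{1000 δ_F C}`, far below `K`.
    rw [ha]
    linarith
  · exact ENNReal.toReal_le_of_le_ofReal (Real.exp_pos _).le hup
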